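/- **Setting.** Let $N\ge 1$, $m,d\ge 0$. For $i=1,\dots,N$ let $\mathcal W_i\subseteq\mathbb R^{n_i}$ and $\mathcal D\subseteq\mathbb R^{d}$ be compact convex sets, and let $f^i:\mathbb R^{n_i}\times\mathbb R^{d}\to\mathbb R$ and the components $g^i_l$ of $g^i:\mathbb R^{n_i}\times\mathbb R^{d}\to\mathbb R^m$ be (jointly) convex. Consider $$\min_{w^i\in\mathcal W_i,\;D\in\mathcal D}\ \sum_{i=1}^N f^i(w^i,D)\quad\text{s.t.}\quad \sum_{i=1}^N g^i(w^i,D)\le 0 ,$$ and put, for $w=(w^i)_i$, $\boldsymbol D=(D^i)_i$, $\boldsymbol z=(z^i)_i$, $$\phi(w,\boldsymbol D,\boldsymbol z)=\sum_{i=1}^N\big(f^i(w^i,D^i)+(z^i)^{\top}g^i(w^i,D^i)\big),\qquad \mathcal L(w,D,z)=\phi\big(w,(D,\dots,D),(z,\dots,z)\big).$$ The optimal dual set is the set of maximizers over $\mathbb R^m_{\ge 0}$ of $q(z)=\inf_{w\in\prod_i\mathcal W_i,\,D\in\mathcal D}\mathcal L(w,D,z)$. Let $r$ be such that the closed ball $\bar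 B(0,r)\subset\mathbb R^m$ contains the optimal dual set. Assume that for all $i$, $l$ and at all points of $\mathcal W_i\times\mathcal D$ the partial subdifferentials satisfy $$\partial_{w}f^i\subseteq\bar B(0,H_{f,w}),\quad \partial_{D}f^i\subseteq\bar B(0,H_{f,D}),\quad \partial_{w}g^i_l\subseteq\bar B(0,H_{g,w}),\quad \partial_{D}g^i_l\subseteq\bar B(0,H_{g,D}).$$ **Graphs.** Let $(\mathcal G_t)_{t\ge1}$ be weighted digraphs on $\{1,\dots,N\}$ with nonnegative adjacency matrices $\mathsf A_t=(\mathsf a_{ij,t})$; $(i,j)$ is an edge iff $\mathsf a_{ij,t}>0$. Assume that each is weight-balanced ($\sum_j\mathsf a_{ij,t}=\sum_j\mathsf a_{ji,t}$ for all $i$), that $\mathsf a_{ij,t}>\delta$ whenever $\mathsf a_{ij,t}>0$ (for a fixed $\delta>0$), and that for some integer $B\ge1$ and every $k\ge 1$ the union $\mathcal G_{kB}\cup\dots\cup\mathcal G_{(k+1)B-1}$ is strongly connected. Let $\mathsf L_t=\operatorname{diag}(\mathsf A_t\mathbf 1)-\mathsf A_t$, let $\Lambda$ bound the maximum singular value of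 every $\mathsf L_t$, and let $d_{\max}=\sup_{t,i}\sum_j\mathsf a_{ij,t}$, assumed finite. For a given $\tilde\delta'\in(0,1)$ let $$\tilde\delta=\min\Big\{\tilde\delta',\,(1-\tilde\delta')\frac{\delta}{d_{\max}}\Big\},\qquad \sigma\in\Big[\frac{\tilde\delta}{\delta},\,\frac{1-\tilde\delta}{d_{\max}}\Big],\qquad C_u=\frac{2^5/3^2}{1-\big(1-\frac{\tilde\delta}{4N^2}\big)^{1/B}}$$ (quotients by $d_{\max}$ count as $+\infty$ if $d_{\max}=0$, which can occur only for $N=1$). **Algorithm (C-SP-SG).** Let $\eta_s=1/\sqrt{2^k}$ for $2^k\le s<2^{k+1}$, $k=0,1,2,\dots$ (Doubling Trick). Starting from $w^i_1\in\mathcal W_i$, $D^i_1\in\mathcal D$, $z^i_1\in\mathbb R^m_{\ge0}\cap\bar B(0,r)$, each agent $i$ iterates for $t\ge1$ $$\begin{aligned} w^i_{t+1}&=P_{\mathcal W_i}\Big(w^i_t-\eta_t\big(a^i_t+\textstyle\sum_{l}z^i_{t,l}\,b^{i,l}_t\big)\Big),\\ D^i_{t+1}&=P_{\mathcal D}\Big(D^i_t+\sigma\textstyle\sum_j\mathsf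 a_{ij,t}(D^j_t-D^i_t)-\eta_t\big(\hat a^i_t+\sum_l z^i_{t,l}\,\hat b^{i,l}_t\big)\Big),\\ z^i_{t+1}&=P_{\mathbb R^m_{\ge0}\cap\bar B(0,r)}\Big(z^i_t+\sigma\textstyle\sum_j\mathsf a_{ij,t}(z^j_t-z^i_t)+\eta_t\,g^i(w^i_t,D^i_t)\Big),\end{aligned}$$ where $P_S$ is the orthogonal projection onto $S$, and $(a^i_t,\hat a^i_t)\in\partial f^i(w^i_t,D^i_t)$ and $(b^{i,l}_t,\hat b^{i,l}_t)\in\partial g^i_l(w^i_t,D^i_t)$ are arbitrary subgradients, written in blocks according to the two arguments. For $t\ge2$ let $x^{\rm av}_t=\frac1{t-1}\sum_{s=1}^{t-1}x_s$ denote the running time-averages. **Conclusion.** Let $(w^*,D^*,z^*)$ be any saddle point of $\mathcal L$ on $(\mathcal W_1\times\dots\times\mathcal W_N)\times\mathcal D\times\mathbb R^m_{\ge0}$ (minimum in $(w,D)$, maximum in $z$). Then for every $t\ge2$ $$-\frac{\hat\alpha_{\mu,z}+\hat\alpha_{w,D}}{2\sqrt{t-1}}\ \le\ \phi(w^{\rm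 av}_t,\boldsymbol D^{\rm av}_t,\boldsymbol z^{\rm av}_t)-\mathcal L(w^*,D^*,z^*)\ \le\ \frac{\hat\alpha_{w,D}+\hat\alpha_{\mu,z}}{2\sqrt{t-1}},$$ where $\hat\alpha_{x,y}=\frac{\sqrt2}{\sqrt2-1}\,\alpha_{x,y}$, $$\alpha_{x,y}=4(B_x^2+B_y^2)+6(H_x^2+H_y^2)+H_y(3+\sigma\Lambda)\,C_u\,(B_y+2H_y),$$ with the nonnegative constants $H$ determined by $$B_\mu=H_\mu=0,\quad B_z=\sqrt N\,r,\quad B_w=\Big(\sum_{i}\operatorname{diam}(\mathcal W_i)^2\Big)^{1/2},\quad B_D=\sqrt N\operatorname{diam}(\mathcal D),$$ $$H_w^2=N(H_{f,w}+r\sqrt m\,H_{g,w})^2,\quad H_D^2=N(H_{f,D}+r\sqrt m\,H_{g,D})^2,\quad H_z^2=\sum_{i}\Big(\sup_{\mathcal W_i\times\mathcal D}\|g^i\|\Big)^2 .$$ -/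

import Mathlib

namespace CSPSG

noncomputable section

/-! ### Weighted digraphs -/

/-- A weighted digraph on `N` vertices, given by its nonnegative weighted adjacency matrix;
`(i, j)` is an edge exactly when the weight `weight i j` is positive. -/
structure WeightedDigraph (N : ℕ) where
  weight : Matrix (Fin N) (Fin N) ℝ
  weight_nonneg : ∀ i j, 0 ≤ weight i j

namespace WeightedDigraph

variable {N : ℕ}

/-- `(i, j)` is an edge. -/
def Edge (G : WeightedDigraph N) (i j : Fin N) : Prop := 0 < G.weight i j

/-- There is a directed path between any two distinct vertices. -/
def StronglyConnected (G : WeightedDigraph N) : Prop :=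
  ∀ i j, i ≠ j → Relation.TransGen G.Edge i j

/-- Weighted out-degree. -/
def outDegree (G : WeightedDigraph N) (i : Fin N) : ℝ := ∑ j, G.weight i j

/-- Weighted in-degree. -/
def inDegree (G : WeightedDigraph N) (i : Fin N) : ℝ := ∑ j, G.weight j i

/-- Out-degree equals in-degree at each vertex. -/
def WeightBalanced (G : WeightedDigraph N) : Prop := ∀ i, G.outDegree i = G.inDegree i

/-- The Laplacian matrix `diag(A 𝟙) - A`. -/
def laplacian (G : WeightedDigraph N) : Matrix (Fin N) (Fin N) ℝ :=
  Matrix.diagonal G.outDegree - G.weight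

/-- The union of a finite family of digraphs on the same vertices (the weights are added). -/
def unionOver (G : ℕ → WeightedDigraph N) (s : Finset ℕ) : WeightedDigraph N where
  weight := fun i j => ∑ t ∈ s, (G t).weight i j
  weight_nonneg := fun i j => Finset.sum_nonneg fun t _ => (G t).weight_nonneg i j

/-- `B`-joint connectivity of the sequence `(G t)_{t ≥ 1}`: for each `k ≥ 1` the union of
`G (k B), …, G ((k + 1) B - 1)` is strongly connected. -/
def JointlyConnected (G : ℕ → WeightedDigraph N) (B : ℕ) : Prop :=
  ∀ k, 1 ≤ k → (unionOver G (Finset.Ico (k * B) ((k + 1) * B))).StronglyConnected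

/-- `δ`-nondegeneracy of the sequence `(G t)_{t ≥ 1}`: positive weights exceed `δ`. -/
def Nondegenerate (G : ℕ → WeightedDigraph N) (δ : ℝ) : Prop :=
  ∀ t, 1 ≤ t → ∀ i j, 0 < (G t).weight i j → δ < (G t).weight i j

/-- All the out-degrees that occur along the sequence `(G t)_{t ≥ 1}`. -/
def outDegrees (G : ℕ → WeightedDigraph N) : Set ℝ :=
  {d | ∃ t, 1 ≤ t ∧ ∃ i, d = (G t).outDegree i}

end WeightedDigraph

/-- The maximum singular value of a real square matrix (singular values are listed in decreasing
order, starting from index `0`). -/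
def maxSingularValue {N : ℕ} (A : Matrix (Fin N) (Fin N) ℝ) : ℝ :=
  (Matrix.toEuclideanLin A).singularValues 0

/-! ### Subgradients and projections -/

section Convex

variable {E F : Type*} [NormedAddCommGroup E] [InnerProductSpace ℝ E]
  [NormedAddCommGroup F] [InnerProductSpace ℝ F]

/-- The subdifferential `∂h(x)` of a function on the whole space. -/
def subdiff (h : E → ℝ) (x : E) : Set E :=
  {ξ | ∀ y, inner ℝ ξ (y - x) ≤ h y - h x}

/-- The (joint) subdifferential of a function of two arguments at the point `(x, y)`; its elements
are written as pairs of blocks. -/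
def jointSubdiff (h : E → F → ℝ) (x : E) (y : F) : Set (E × F) :=
  {ξ | ∀ x' y', inner ℝ ξ.1 (x' - x) + inner ℝ ξ.2 (y' - y) ≤ h x' y' - h x y}

/-- `p` is the orthogonal projection of `x` onto `S`. -/
def IsOrthProj (S : Set E) (x p : E) : Prop :=
  p ∈ S ∧ ∀ y ∈ S, ‖x - p‖ ≤ ‖x - y‖

end Convex

/-! ### The optimization problem -/

/-- The data of `min ∑ i, f i (w i, D)` subject to `∑ i, g i (w i, D) ≤ 0`, with `w i ∈ W i` and
`D ∈ Dset`, for `N` agents, `m` scalar constraints and a global decision vector in `ℝ^d`. -/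
structure Problem (N m d : ℕ) where
  /-- dimensions of the local decision vectors -/
  n : Fin N → ℕ
  W : ∀ i, Set (EuclideanSpace ℝ (Fin (n i)))
  Dset : Set (EuclideanSpace ℝ (Fin d))
  f : ∀ i, EuclideanSpace ℝ (Fin (n i)) → EuclideanSpace ℝ (Fin d) → ℝ
  g : ∀ i, EuclideanSpace ℝ (Fin (n i)) → EuclideanSpace ℝ (Fin d) → EuclideanSpace ℝ (Fin m)
  convex_W : ∀ i, Convex ℝ (W i)
  convex_Dset : Convex ℝ Dset
  convex_f : ∀ i, ConvexOn ℝ Set.univ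
    (fun p : EuclideanSpace ℝ (Fin (n i)) × EuclideanSpace ℝ (Fin d) => f i p.1 p.2)
  convex_g : ∀ i l, ConvexOn ℝ Set.univ
    (fun p : EuclideanSpace ℝ (Fin (n i)) × EuclideanSpace ℝ (Fin d) => g i p.1 p.2 l)

/-- The nonnegative orthant of `ℝ^m`. -/
def orthant (m : ℕ) : Set (EuclideanSpace ℝ (Fin m)) := {z | ∀ l, 0 ≤ z l}

namespace Problem

variable {N m d : ℕ} (P : Problem N m d)

/-- The local decision vectors of all the agents. -/
abbrev Locals : Type := ∀ i, EuclideanSpace ℝ (Fin (P.n i))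

/-- The convex-concave function
`φ(w, D, z) = ∑ i, (f i (w i, D i) + (z i)ᵀ g i (w i, D i))`, where each agent has its own copies
`D i` and `z i` of the global decision vector and of the multiplier. -/
def phi (w : P.Locals) (D : Fin N → EuclideanSpace ℝ (Fin d))
    (z : Fin N → EuclideanSpace ℝ (Fin m)) : ℝ :=
  ∑ i, (P.f i (w i) (D i) + inner ℝ (z i) (P.g i (w i) (D i)))

/-- The Lagrangian: `φ` under agreement of all the copies. -/
def lagrangian (w : P.Locals) (D : EuclideanSpace ℝ (Fin d)) (z : EuclideanSpace ℝ (Fin m)) : ℝ :=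
  P.phi w (fun _ => D) (fun _ => z)

/-- The dual function, the infimum of the Lagrangian over the primal sets. -/
def dualFunction (z : EuclideanSpace ℝ (Fin m)) : EReal :=
  ⨅ (w : P.Locals) (_ : ∀ i, w i ∈ P.W i) (D : EuclideanSpace ℝ (Fin d)) (_ : D ∈ P.Dset),
    ((P.lagrangian w D z : ℝ) : EReal)

/-- The optimal dual set: the maximizers of the dual function over the nonnegative orthant. -/
def optimalDualSet : Set (EuclideanSpace ℝ (Fin m)) :=
  {z | z ∈ orthant m ∧ ∀ z' ∈ orthant m, P.dualFunction z' ≤ P.dualFunction z}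

/-- `(w, D, z)` is a saddle point of the Lagrangian on `(W_1 × ⋯ × W_N) × Dset × ℝ^m_{≥ 0}`. -/
structure IsSaddle (w : P.Locals) (D : EuclideanSpace ℝ (Fin d))
    (z : EuclideanSpace ℝ (Fin m)) : Prop where
  w_mem : ∀ i, w i ∈ P.W i
  D_mem : D ∈ P.Dset
  z_mem : z ∈ orthant m
  primal : ∀ w' D', (∀ i, w' i ∈ P.W i) → D' ∈ P.Dset →
    P.lagrangian w D z ≤ P.lagrangian w' D' z
  dual : ∀ z' ∈ orthant m, P.lagrangian w D z' ≤ P.lagrangian w D z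

/-! ### The algorithm -/

/-- The set onto which the multiplier estimates are projected. -/
def multiplierSet (m : ℕ) (r : ℝ) : Set (EuclideanSpace ℝ (Fin m)) :=
  orthant m ∩ Metric.closedBall 0 r

/-- One update of agent `i`, from the network state `(w, D, z)` to its new state `(wi, Di, zi)`,
with consensus stepsize `σ`, learning rate `η` and digraph `G`. The pair `a` collects the
subgradients of `f i` in the first and in the second argument; the pair `b l` those of the `l`-th
component of `g i`. In each pair the two blocks come from one and the same subgradient of the jointly
convex function; each block is then a subgradient in the respective argument. -/
def AgentStep (r σ η : ℝ) (G : WeightedDigraph N) (i : Fin N)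
    (w : P.Locals) (D : Fin N → EuclideanSpace ℝ (Fin d)) (z : Fin N → EuclideanSpace ℝ (Fin m))
    (wi : EuclideanSpace ℝ (Fin (P.n i))) (Di : EuclideanSpace ℝ (Fin d))
    (zi : EuclideanSpace ℝ (Fin m)) : Prop :=
  ∃ (a : EuclideanSpace ℝ (Fin (P.n i)) × EuclideanSpace ℝ (Fin d))
    (b : Fin m → EuclideanSpace ℝ (Fin (P.n i)) × EuclideanSpace ℝ (Fin d)),
    a ∈ jointSubdiff (P.f i) (w i) (D i) ∧
    (∀ l, b l ∈ jointSubdiff (fun x y => P.g i x y l) (w i) (D i)) ∧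
    IsOrthProj (P.W i) (w i - η • (a.1 + ∑ l, z i l • (b l).1)) wi ∧
    IsOrthProj P.Dset
      (D i + σ • (∑ j, G.weight i j • (D j - D i)) - η • (a.2 + ∑ l, z i l • (b l).2)) Di ∧
    IsOrthProj (multiplierSet m r)
      (z i + σ • (∑ j, G.weight i j • (z j - z i)) + η • P.g i (w i) (D i)) zi

/-- The sequence `(w t, D t, z t)_{t ≥ 1}` is generated by the C-SP-SG algorithm, initialized in
the constraint sets. -/
structure IsTrajectory (r σ : ℝ) (η : ℕ → ℝ) (G : ℕ → WeightedDigraph N)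
    (w : ℕ → P.Locals) (D : ℕ → Fin N → EuclideanSpace ℝ (Fin d))
    (z : ℕ → Fin N → EuclideanSpace ℝ (Fin m)) : Prop where
  init_w : ∀ i, w 1 i ∈ P.W i
  init_D : ∀ i, D 1 i ∈ P.Dset
  init_z : ∀ i, z 1 i ∈ multiplierSet m r
  step : ∀ t, 1 ≤ t → ∀ i,
    P.AgentStep r σ (η t) (G t) i (w t) (D t) (z t) (w (t + 1) i) (D (t + 1) i) (z (t + 1) i)

/-! ### Constants of the problem -/

/-- `B_w = (∑ i, diam(W i)²)^{1/2}`. -/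
def Bw : ℝ := Real.sqrt (∑ i, Metric.diam (P.W i) ^ 2)

/-- `B_D = √N diam(Dset)`. -/
def BD : ℝ := Real.sqrt N * Metric.diam P.Dset

/-- `H_z = (∑ i, (sup ‖g i‖)²)^{1/2}`, the supremum being over `W i × Dset`. -/
def Hz : ℝ :=
  Real.sqrt (∑ i, sSup ((fun p : EuclideanSpace ℝ (Fin (P.n i)) × EuclideanSpace ℝ (Fin d) =>
    ‖P.g i p.1 p.2‖) '' (P.W i ×ˢ P.Dset)) ^ 2)

end Problem

/-- `B_z = √N r`. -/
def Bz (N : ℕ) (r : ℝ) : ℝ := Real.sqrt N * r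

/-- The bound `(N (Hf + r √m Hg)²)^{1/2}`, which is `H_w` and `H_D`, according to whether `Hf` and
`Hg` bound the subgradients in the local or in the global decision vector. -/
def Hprimal (N m : ℕ) (r Hf Hg : ℝ) : ℝ :=
  Real.sqrt (N * (Hf + r * Real.sqrt m * Hg) ^ 2)

/-- `δ̃ = min {δ', (1 - δ') δ / dmax}`; the second entry counts as `+∞` when `dmax = 0` (a single
agent). -/
def tildeDelta (δ' δ dmax : ℝ) : ℝ :=
  if dmax = 0 then δ' else min δ' ((1 - δ') * (δ / dmax))

/-- `σ ∈ [δ̃ / δ, (1 - δ̃) / dmax]`; the right end counts as `+∞` when `dmax = 0`. -/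
def StepsizeCond (σ δt δ dmax : ℝ) : Prop :=
  δt / δ ≤ σ ∧ (dmax ≠ 0 → σ ≤ (1 - δt) / dmax)

/-- `C_u = (2⁵/3²) / (1 - (1 - δ̃ / (4 N²))^{1/B})`. -/
def Cu (N B : ℕ) (δt : ℝ) : ℝ :=
  (2 ^ 5 / 3 ^ 2) / (1 - (1 - δt / (4 * (N : ℝ) ^ 2)) ^ (1 / (B : ℝ)))

/-- `α = 4 (B₁² + B₂²) + 6 (H₁² + H₂²) + H₂ (3 + σ Λ) C_u (B₂ + 2 H₂)`, where the second variable
is the one subject to agreement. -/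
def alpha (B₁ B₂ H₁ H₂ σ Λ C : ℝ) : ℝ :=
  4 * (B₁ ^ 2 + B₂ ^ 2) + 6 * (H₁ ^ 2 + H₂ ^ 2) + H₂ * (3 + σ * Λ) * C * (B₂ + 2 * H₂)

/-- `α̂ = √2 / (√2 - 1) α`. -/
def alphaHat (B₁ B₂ H₁ H₂ σ Λ C : ℝ) : ℝ :=
  Real.sqrt 2 / (Real.sqrt 2 - 1) * alpha B₁ B₂ H₁ H₂ σ Λ C

/-- The Doubling Trick: in epoch `k = 0, 1, 2, …`, made of the times `2^k, …, 2^(k+1) - 1`, the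
learning rate is constant, equal to `1 / √(2^k)`. -/
def DoublingTrick (η : ℕ → ℝ) : Prop :=
  ∀ k s : ℕ, 2 ^ k ≤ s → s < 2 ^ (k + 1) → η s = 1 / Real.sqrt (2 ^ k)

/-- The running time-average `x^av_t = (1 / (t - 1)) ∑_{s = 1}^{t - 1} x_s`, for `t ≥ 2`. -/
def runAvg {X : Type*} [AddCommGroup X] [Module ℝ X] (x : ℕ → X) (t : ℕ) : X :=
  ((t : ℝ) - 1)⁻¹ • ∑ s ∈ Finset.Ico 1 t, x s

end

end CSPSG

/-! The proof plays regret bounds against the two saddle inequalities. For fixed nonnegative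
multipliers each agent's term is jointly convex in its two primal arguments, so the primal updates
are projected subgradient descent; in the multipliers it is affine, so their update is projected
gradient ascent. The inequality `IsOrthProj.two_mul_inner_le` telescopes over an epoch of constant
learning rate. Epoch k then costs a multiple of √(2^k), and these costs add up geometrically, which
is the origin of √2/(√2 - 1) (`sum_le_of_epochs`).

The agents hold different copies of D and z. The consensus step multiplies by the doubly stochastic
matrix 1 - σL, which does not increase the sum of squared distances to a common point; so the
telescoping survives, at the price of σΛH times the disagreement (`ConsensusSeq.sum_regret_le`). The
disagreement is a geometrically contracted quantity disturbed by steps of size at most ηH. The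
contraction comes from `variance_window`: over one connected window every gap between consecutive
sorted values is crossed by some averaging step, and the first crossing dissipates a fixed fraction
of the squared gap. Summing the geometric series gives C_u (`sum_disagreement_perturbed`).

Running averages enter by convexity in the primal variables and linearity in z. For the upper bound
the comparators are the primal saddle point and the mean over the agents of the averaged
multipliers. For the lower bound they are the averaged w, the mean of the averaged D, and z*, which
lies in the projection ball because saddle multipliers are dual optimal. Saddle inequalities speak
only of agreeing copies, so in each direction copies of one variable are replaced by their mean
twice, at a cost of H times the disagreement (`phi_sub_phi_mean_le`,
`SubdiffBounds.phi_mean_sub_le`). -/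

namespace CSPSG

/-! ### Variance decay under products of doubly stochastic matrices. -/

section Averaging

open Matrix Finset

/-- A doubly stochastic matrix whose diagonal entries and whose nonzero entries are at least `e`. -/
structure IsAveraging {ι : Type*} [Fintype ι] [DecidableEq ι] (e : ℝ) (A : Matrix ι ι ℝ) :
    Prop where
  mem : A ∈ doublyStochastic ℝ ι
  diag : ∀ i, e ≤ A i i
  entry : ∀ i j, A i j ≠ 0 → e ≤ A i j

/-- A nonzero entry of `A` joins `S` and its complement. -/
def Crosses {ι : Type*} (A : Matrix ι ι ℝ) (S : Finset ι) : Prop :=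
  ∃ i ∈ S, ∃ j, j ∉ S ∧ (A i j ≠ 0 ∨ A j i ≠ 0)

section Cut

variable {ι : Type*} [Fintype ι] [DecidableEq ι]

/-- With p k the mass that row k puts on S, the cut weight is ∑ p k (1 - p k). Double stochasticity
balances the mass leaving S with the mass entering it, so a crossing entry in either direction makes
both at least e. -/
theorem sum_gram_cut {e : ℝ} (he : 0 ≤ e) {A : Matrix ι ι ℝ} (hA : IsAveraging e A)
    {S : Finset ι} (hS : Crosses A S) :
    e / 2 ≤ ∑ i ∈ S, ∑ j ∈ Sᶜ, (Aᵀ * A) i j := by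
  have hnn : ∀ i j, 0 ≤ A i j := fun i j => hA.mem.1 i j
  have hrow := fun i => sum_row_of_mem_doublyStochastic hA.mem i
  have hcol := fun i => sum_col_of_mem_doublyStochastic hA.mem i
  set p : ι → ℝ := fun k => ∑ i ∈ S, A k i with hp
  have hq : ∀ k, ∑ j ∈ Sᶜ, A k j = 1 - p k := fun k => by
    have := sum_add_sum_compl S (fun j => A k j)
    rw [hrow k] at this
    simp only [hp]; linarith
  have hp0 : ∀ k, 0 ≤ p k := fun k => sum_nonneg fun i _ => hnn k i
  have hp1 : ∀ k, 0 ≤ 1 - p k := fun k => by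
    rw [← hq]; exact sum_nonneg fun i _ => hnn k i
  have key : ∑ i ∈ S, ∑ j ∈ Sᶜ, (Aᵀ * A) i j = ∑ k, p k * (1 - p k) := by
    simp only [mul_apply, transpose_apply]
    simp_rw [← hq, hp, sum_mul_sum]
    rw [sum_comm (s := univ)]
    exact sum_congr rfl fun i _ => sum_comm
  have hflow : ∑ k ∈ S, (1 - p k) = ∑ k ∈ Sᶜ, p k := by
    have h1 : ∑ k ∈ S, p k + ∑ k ∈ Sᶜ, p k = S.card := by
      rw [sum_add_sum_compl]
      calc ∑ k, p k = ∑ i ∈ S, ∑ k, A k i := sum_comm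
        _ = _ := by simp [hcol]
    simp only [sum_sub_distrib, sum_const, nsmul_eq_mul, mul_one]
    linarith
  have hflow_le : e ≤ ∑ k ∈ Sᶜ, p k := by
    obtain ⟨i, hi, j, hj, h | h⟩ := hS
    · rw [← hflow]
      refine (hA.entry i j h).trans ?_
      refine le_trans ?_ (single_le_sum (f := fun k => 1 - p k) (fun k _ => hp1 k) hi)
      rw [← hq]
      exact single_le_sum (f := fun j => A i j) (fun k _ => hnn i k) (by simpa using hj)
    · refine (hA.entry j i h).trans ?_
      refine le_trans ?_ (single_le_sum (f := fun k => p k) (fun k _ => hp0 k)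
        (by simpa using hj))
      exact single_le_sum (f := fun i => A j i) (fun k _ => hnn j k) hi
  rw [key]
  -- If each row keeps at least half of its mass on its own side, p (1 - p) is at least half the
  -- crossing mass. Otherwise one exceptional row suffices: its diagonal entry keeps mass e on its
  -- own side, and more than half crosses.
  by_cases h : (∀ k ∈ S, 1 / 2 ≤ p k) ∧ ∀ k ∈ Sᶜ, p k ≤ 1 / 2
  · rw [← sum_add_sum_compl S]
    have h1 : ∑ k ∈ S, (1 - p k) / 2 ≤ ∑ k ∈ S, p k * (1 - p k) :=
      sum_le_sum fun k hk => by nlinarith [h.1 k hk, hp1 k]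
    have h2 : ∑ k ∈ Sᶜ, p k / 2 ≤ ∑ k ∈ Sᶜ, p k * (1 - p k) :=
      sum_le_sum fun k hk => by nlinarith [h.2 k hk, hp0 k]
    rw [← sum_div] at h1 h2
    rw [hflow] at h1
    linarith
  · have : ∃ k, e / 2 ≤ p k * (1 - p k) := by
      rw [not_and_or] at h
      push Not at h
      rcases h with ⟨k, hk, hlt⟩ | ⟨k, hk, hlt⟩
      · refine ⟨k, ?_⟩
        have : e ≤ p k := (hA.diag k).trans
          (single_le_sum (f := fun i => A k i) (fun i _ => hnn k i) hk)
        nlinarith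
      · refine ⟨k, ?_⟩
        have : e ≤ 1 - p k := by
          rw [← hq]
          exact (hA.diag k).trans (single_le_sum (f := fun i => A k i) (fun i _ => hnn k i) hk)
        nlinarith
    obtain ⟨k, hk⟩ := this
    exact hk.trans (single_le_sum (f := fun k => p k * (1 - p k))
      (fun k _ => mul_nonneg (hp0 k) (hp1 k)) (mem_univ k))

/-- Expand the squares: the rows and columns of the doubly stochastic AᵀA sum to one, and its
quadratic form is the squared norm of A x. The loss of energy is thus a sum over pairs, weighted by
AᵀA. -/
theorem sum_sq_sub_sum_sq_mulVec {A : Matrix ι ι ℝ} (hA : A ∈ doublyStochastic ℝ ι) (x : ι → ℝ) :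
    ∑ i, x i ^ 2 - ∑ i, (A *ᵥ x) i ^ 2 =
      (∑ i, ∑ j, (Aᵀ * A) i j * (x i - x j) ^ 2) / 2 := by
  have hW : Aᵀ * A ∈ doublyStochastic ℝ ι :=
    mul_mem (transpose_mem_doublyStochastic_iff.2 hA) hA
  have h1 : ∑ i, ∑ j, (Aᵀ * A) i j * x i ^ 2 = ∑ i, x i ^ 2 :=
    sum_congr rfl fun i _ => by
      rw [← sum_mul, sum_row_of_mem_doublyStochastic hW, one_mul]
  have h2 : ∑ i, ∑ j, (Aᵀ * A) i j * x j ^ 2 = ∑ i, x i ^ 2 := by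
    rw [sum_comm]
    exact sum_congr rfl fun i _ => by
      rw [← sum_mul, sum_col_of_mem_doublyStochastic hW, one_mul]
  have h3 : ∑ i, (A *ᵥ x) i ^ 2 = ∑ i, ∑ j, (Aᵀ * A) i j * (x i * x j) := by
    have : ∑ i, (A *ᵥ x) i ^ 2 = x ⬝ᵥ ((Aᵀ * A) *ᵥ x) := by
      rw [← mulVec_mulVec, dotProduct_mulVec, vecMul_transpose, dotProduct]
      exact sum_congr rfl fun i _ => sq _
    rw [this, dotProduct]
    refine sum_congr rfl fun i _ => ?_
    rw [mulVec, dotProduct, mul_sum]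
    exact sum_congr rfl fun j _ => by ring
  have h4 : ∑ i, ∑ j, (Aᵀ * A) i j * (x i - x j) ^ 2 =
      ∑ i, ∑ j, (Aᵀ * A) i j * x i ^ 2 + ∑ i, ∑ j, (Aᵀ * A) i j * x j ^ 2
        - 2 * ∑ i, ∑ j, (Aᵀ * A) i j * (x i * x j) := by
    rw [mul_sum, ← sum_add_distrib, ← sum_sub_distrib]
    refine sum_congr rfl fun i _ => ?_
    rw [mul_sum, ← sum_add_distrib, ← sum_sub_distrib]
    exact sum_congr rfl fun j _ => by ring
  rw [h4, h1, h2, h3]; ring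

end Cut

section Window

variable {n : ℕ}

/-- The first `l + 1` indices. -/
def lowerCut (n l : ℕ) : Finset (Fin n) := univ.filter fun i => i.val ≤ l

theorem mem_lowerCut {l : ℕ} {i : Fin n} : i ∈ lowerCut n l ↔ i.val ≤ l := by simp [lowerCut]

/-- The selected gaps are non-overlapping subintervals of [x i, x j], and for nonnegative lengths
the sum of squares is at most the square of the sum. -/
theorem sum_gap_sq_le {Y : ℕ → ℝ} (hY : Monotone Y) {x : Fin n → ℝ} {D : Finset ℕ}
    (hlow : ∀ l ∈ D, ∀ i : Fin n, i.val ≤ l → x i ≤ Y l)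
    (hup : ∀ l ∈ D, ∀ i : Fin n, l < i.val → Y (l + 1) ≤ x i) (i j : Fin n) :
    ∑ l ∈ D.filter (fun l => i.val ≤ l ∧ l < j.val), (Y (l + 1) - Y l) ^ 2 ≤ (x j - x i) ^ 2 := by
  set F := D.filter (fun l => i.val ≤ l ∧ l < j.val) with hF
  have hg : ∀ l, 0 ≤ Y (l + 1) - Y l := fun l => sub_nonneg.2 (hY (Nat.le_succ l))
  rcases F.eq_empty_or_nonempty with h | h
  · simp [h, sq_nonneg]
  · have h1 := mem_filter.1 (F.min'_mem h)
    have h2 := mem_filter.1 (F.max'_mem h)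
    have hx1 := hlow _ h1.1 i h1.2.1
    have hx2 := hup _ h2.1 j h2.2.2
    refine (sum_sq_le_sq_sum_of_nonneg fun l _ => hg l).trans ?_
    refine pow_le_pow_left₀ (sum_nonneg fun l _ => hg l) ?_ 2
    have hsub : F ⊆ Ico (F.min' h) (F.max' h + 1) := fun l hl => by
      have a := F.min'_le l hl
      have b := F.le_max' l hl
      rw [mem_Ico]; omega
    refine (sum_le_sum_of_subset_of_nonneg hsub fun l _ _ => hg l).trans ?_
    rw [sum_Ico_sub Y (by have := F.min'_le _ (F.max'_mem h); omega)]
    linarith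

/-- Here D collects the gaps that are still free of values and whose cut A crosses. Each pair's
squared difference dominates the squared gaps it spans; exchanging the sums gives each gap its full
cut weight, bounded below by `sum_gram_cut`. -/
theorem sum_sq_decrease_step {e : ℝ} (he : 0 ≤ e) {A : Matrix (Fin n) (Fin n) ℝ}
    (hA : IsAveraging e A) {Y : ℕ → ℝ} (hY : Monotone Y) {x : Fin n → ℝ} {D : Finset ℕ}
    (hlow : ∀ l ∈ D, ∀ i : Fin n, i.val ≤ l → x i ≤ Y l)
    (hup : ∀ l ∈ D, ∀ i : Fin n, l < i.val → Y (l + 1) ≤ x i)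
    (hcross : ∀ l ∈ D, Crosses A (lowerCut n l)) :
    e / 2 * ∑ l ∈ D, (Y (l + 1) - Y l) ^ 2 ≤ ∑ i, x i ^ 2 - ∑ i, (A *ᵥ x) i ^ 2 := by
  rw [sum_sq_sub_sum_sq_mulVec hA.mem]
  have hW : Aᵀ * A ∈ doublyStochastic ℝ (Fin n) :=
    mul_mem (transpose_mem_doublyStochastic_iff.2 hA.mem) hA.mem
  have hsymm : ∀ i j, (Aᵀ * A) i j = (Aᵀ * A) j i := fun i j => by
    simp only [mul_apply, transpose_apply]
    exact sum_congr rfl fun k _ => mul_comm _ _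
  set W := Aᵀ * A with hWdef
  set c : ℕ → Fin n → Fin n → ℝ :=
    fun l i j => if i.val ≤ l ∧ l < j.val then 1 else 0 with hc
  -- For each pair only one of the two indicators can be nonzero, according to the order of i and j.
  have hpair : ∀ i j, W i j * ∑ l ∈ D, (c l i j + c l j i) * (Y (l + 1) - Y l) ^ 2 ≤
      W i j * (x i - x j) ^ 2 := by
    intro i j
    refine mul_le_mul_of_nonneg_left ?_ (hW.1 i j)
    have hs : ∀ i j : Fin n, ∑ l ∈ D, c l i j * (Y (l + 1) - Y l) ^ 2 =
        ∑ l ∈ D.filter (fun l => i.val ≤ l ∧ l < j.val), (Y (l + 1) - Y l) ^ 2 := by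
      intro i j
      rw [sum_filter]
      exact sum_congr rfl fun l _ => by simp [hc]
    simp only [add_mul, sum_add_distrib, hs]
    rcases le_total i j with hij | hij
    · have : D.filter (fun l => j.val ≤ l ∧ l < i.val) = ∅ :=
        filter_eq_empty_iff.2 fun l _ => by have : i.val ≤ j.val := hij; omega
      rw [this, sum_empty, add_zero, ← neg_sq (x i - x j), neg_sub]
      exact sum_gap_sq_le hY hlow hup i j
    · have : D.filter (fun l => i.val ≤ l ∧ l < j.val) = ∅ :=
        filter_eq_empty_iff.2 fun l _ => by have : j.val ≤ i.val := hij; omega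
      rw [this, sum_empty, zero_add]
      exact sum_gap_sq_le hY hlow hup j i
  have hcut : ∀ l ∈ D, e / 2 ≤ ∑ i, ∑ j, W i j * c l i j := by
    intro l hl
    refine (sum_gram_cut he hA (hcross l hl)).trans (le_of_eq ?_)
    rw [← sum_filter_add_sum_filter_not univ (fun i : Fin n => i.val ≤ l)
      (fun i => ∑ j, W i j * c l i j)]
    have h0 : ∑ i with ¬ i.val ≤ l, ∑ j, W i j * c l i j = 0 :=
      sum_eq_zero fun i hi => sum_eq_zero fun j _ => by
        have := (mem_filter.1 hi).2
        simp [hc, this]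
    rw [h0, add_zero]
    refine sum_congr rfl fun i hi => ?_
    have hi' := (mem_filter.1 hi).2
    have : (lowerCut n l)ᶜ = univ.filter fun j : Fin n => l < j.val := by
      ext j; simp [mem_lowerCut]
    rw [this, sum_filter]
    exact sum_congr rfl fun j _ => by simp [hc, hi', ← hWdef]
  have htot : ∑ l ∈ D, (Y (l + 1) - Y l) ^ 2 * (∑ i, ∑ j, W i j * c l i j +
      ∑ i, ∑ j, W i j * c l j i) ≤ ∑ i, ∑ j, W i j * (x i - x j) ^ 2 := by
    refine le_trans (le_of_eq ?_) (sum_le_sum fun i _ => sum_le_sum fun j _ => hpair i j)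
    simp_rw [← sum_add_distrib, mul_sum]
    rw [sum_comm]
    refine sum_congr rfl fun i _ => ?_
    rw [sum_comm]
    exact sum_congr rfl fun j _ => sum_congr rfl fun l _ => by ring
  -- Counting each cut in both directions compensates the factor 1/2 in the energy identity.
  have hswap : ∀ l, ∑ i, ∑ j, W i j * c l j i = ∑ i, ∑ j, W i j * c l i j := fun l => by
    rw [sum_comm]
    exact sum_congr rfl fun i _ => sum_congr rfl fun j _ => by rw [hsymm]
  have : ∑ l ∈ D, (Y (l + 1) - Y l) ^ 2 * e ≤ ∑ l ∈ D, (Y (l + 1) - Y l) ^ 2 *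
      (∑ i, ∑ j, W i j * c l i j + ∑ i, ∑ j, W i j * c l j i) :=
    sum_le_sum fun l hl => by
      rw [hswap]
      have := hcut l hl
      exact mul_le_mul_of_nonneg_left (by linarith) (sq_nonneg _)
  rw [← sum_mul] at this
  linarith

theorem mulVec_le_of_not_crosses {A : Matrix (Fin n) (Fin n) ℝ}
    (hA : A ∈ doublyStochastic ℝ (Fin n)) {S : Finset (Fin n)} (hS : ¬ Crosses A S)
    {x : Fin n → ℝ} {a b : ℝ} (hlow : ∀ i ∈ S, x i ≤ a) (hup : ∀ i ∉ S, b ≤ x i) :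
    (∀ i ∈ S, (A *ᵥ x) i ≤ a) ∧ ∀ i ∉ S, b ≤ (A *ᵥ x) i := by
  have hrow := fun i => sum_row_of_mem_doublyStochastic hA i
  have hz : ∀ i ∈ S, ∀ j, j ∉ S → A i j = 0 ∧ A j i = 0 := fun i hi j hj => by
    by_contra h
    exact hS ⟨i, hi, j, hj, by tauto⟩
  constructor
  · intro i hi
    calc (A *ᵥ x) i = ∑ j, A i j * x j := rfl
      _ ≤ ∑ j, A i j * a := sum_le_sum fun j _ => by
        by_cases hj : j ∈ S
        · exact mul_le_mul_of_nonneg_left (hlow j hj) (hA.1 i j)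
        · simp [(hz i hi j hj).1]
      _ = a := by rw [← sum_mul, hrow, one_mul]
  · intro i hi
    calc b = ∑ j, A i j * b := by rw [← sum_mul, hrow, one_mul]
      _ ≤ ∑ j, A i j * x j := sum_le_sum fun j _ => by
        by_cases hj : j ∈ S
        · simp [(hz j hj i hi).2]
        · exact mul_le_mul_of_nonneg_left (hup j hj) (hA.1 i j)

/-- Each initial gap is charged to the first time its cut is crossed, so the energy losses at
different times pay for disjoint sets of gaps. -/
theorem sum_sq_decrease_window {e : ℝ} (he : 0 ≤ e) {A : ℕ → Matrix (Fin n) (Fin n) ℝ}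
    (hA : ∀ t, IsAveraging e (A t)) {Y : ℕ → ℝ} (hY : Monotone Y) {x : ℕ → Fin n → ℝ}
    (hx0 : ∀ i, x 0 i = Y i) (hx : ∀ t, x (t + 1) = A t *ᵥ x t) (T : ℕ)
    (hcross : ∀ l, l + 1 < n → ∃ t < T, Crosses (A t) (lowerCut n l)) :
    e / 2 * ∑ l ∈ range (n - 1), (Y (l + 1) - Y l) ^ 2 ≤
      ∑ i, x 0 i ^ 2 - ∑ i, x T i ^ 2 := by
  classical
  -- Until the cut is crossed its two sides average separately, so no value enters the open gap.
  have hinv : ∀ l t, (∀ s < t, ¬ Crosses (A s) (lowerCut n l)) →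
      (∀ i ∈ lowerCut n l, x t i ≤ Y l) ∧ ∀ i ∉ lowerCut n l, Y (l + 1) ≤ x t i := by
    intro l t
    induction t with
    | zero =>
      intro _
      simp only [mem_lowerCut, hx0]
      exact ⟨fun i hi => hY hi, fun i hi => hY (by omega)⟩
    | succ t ih =>
      intro h
      obtain ⟨h1, h2⟩ := ih fun s hs => h s (by omega)
      rw [hx]
      exact mulVec_le_of_not_crosses (hA t).mem (h t (by omega)) h1 h2
  have hfirst : ∀ l, ∃ t, l + 1 < n → t < T ∧ Crosses (A t) (lowerCut n l) ∧
      ∀ s < t, ¬ Crosses (A s) (lowerCut n l) := by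
    intro l
    by_cases hl : l + 1 < n
    · have hex := hcross l hl
      have hex' : ∃ t, Crosses (A t) (lowerCut n l) := hex.imp fun t h => h.2
      refine ⟨Nat.find hex', fun _ => ⟨?_, Nat.find_spec hex', fun s hs => Nat.find_min hex' hs⟩⟩
      obtain ⟨t, htT, ht⟩ := hex
      exact (Nat.find_min' hex' ht).trans_lt htT
    · exact ⟨0, fun h => absurd h hl⟩
  choose τ hτ using hfirst
  have hmaps : ∀ l ∈ range (n - 1), τ l ∈ range T := fun l hl => by
    have := mem_range.1 hl
    exact mem_range.2 (hτ l (by omega)).1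
  rw [← sum_fiberwise_of_maps_to hmaps, mul_sum, ← sum_range_sub' (fun t => ∑ i, x t i ^ 2)]
  refine sum_le_sum fun t _ => ?_
  rw [hx]
  have hmem : ∀ l ∈ (range (n - 1)).filter (fun l => τ l = t),
      Crosses (A t) (lowerCut n l) ∧ ∀ s < t, ¬ Crosses (A s) (lowerCut n l) := fun l hl => by
    obtain ⟨h1, h2⟩ := mem_filter.1 hl
    have := mem_range.1 h1
    have := hτ l (by omega)
    rw [h2] at this
    exact this.2
  refine sum_sq_decrease_step he (hA t) hY ?_ ?_ fun l hl => (hmem l hl).1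
  · intro l hl i hi
    exact (hinv l t (hmem l hl).2).1 i (mem_lowerCut.2 hi)
  · intro l hl i hi
    exact (hinv l t (hmem l hl).2).2 i (by rw [mem_lowerCut]; omega)

/-- The mean of a finite family of vectors. -/
noncomputable def mean {E : Type*} [AddCommGroup E] [Module ℝ E] (x : Fin n → E) : E :=
  (n : ℝ)⁻¹ • ∑ i, x i

/-- Every deviation is at most the range, which is the sum of the gaps: one factor n counts the
terms, the other comes from Cauchy–Schwarz. -/
theorem sum_sq_sub_mean_le {Y : ℕ → ℝ} (hY : Monotone Y) {x : Fin n → ℝ} (hx : ∀ i, x i = Y i) :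
    ∑ i, (x i - mean x) ^ 2 ≤ (n : ℝ) ^ 2 * ∑ l ∈ range (n - 1), (Y (l + 1) - Y l) ^ 2 := by
  rcases Nat.eq_zero_or_pos n with rfl | hn
  · simp
  have hn' : (0 : ℝ) < n := by exact_mod_cast hn
  have hlo : ∀ i, Y 0 ≤ x i := fun i => by rw [hx]; exact hY (Nat.zero_le _)
  have hhi : ∀ i, x i ≤ Y (n - 1) := fun i => by rw [hx]; exact hY (by omega)
  have hm1 : Y 0 ≤ mean x := by
    rw [mean, smul_eq_mul, ← div_eq_inv_mul, le_div_iff₀ hn', mul_comm]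
    calc (n : ℝ) * Y 0 = ∑ _i : Fin n, Y 0 := by simp
      _ ≤ _ := sum_le_sum fun i _ => hlo i
  have hm2 : mean x ≤ Y (n - 1) := by
    rw [mean, smul_eq_mul, ← div_eq_inv_mul, div_le_iff₀ hn', mul_comm]
    calc ∑ i, x i ≤ ∑ _i : Fin n, Y (n - 1) := sum_le_sum fun i _ => hhi i
      _ = _ := by simp
  have hpt : ∀ i, (x i - mean x) ^ 2 ≤ (Y (n - 1) - Y 0) ^ 2 := fun i =>
    sq_le_sq' (by linarith [hlo i]) (by linarith [hhi i])
  have htel : Y (n - 1) - Y 0 = ∑ l ∈ range (n - 1), (Y (l + 1) - Y l) := (sum_range_sub Y _).symm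
  have hcs : (Y (n - 1) - Y 0) ^ 2 ≤ n * ∑ l ∈ range (n - 1), (Y (l + 1) - Y l) ^ 2 := by
    rw [htel]
    refine (sq_sum_le_card_mul_sum_sq).trans ?_
    refine mul_le_mul_of_nonneg_right ?_ (sum_nonneg fun _ _ => sq_nonneg _)
    rw [card_range]; exact_mod_cast Nat.sub_le n 1
  calc ∑ i, (x i - mean x) ^ 2 ≤ ∑ _i : Fin n, (Y (n - 1) - Y 0) ^ 2 :=
        sum_le_sum fun i _ => hpt i
    _ = n * (Y (n - 1) - Y 0) ^ 2 := by simp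
    _ ≤ n * (n * ∑ l ∈ range (n - 1), (Y (l + 1) - Y l) ^ 2) :=
        mul_le_mul_of_nonneg_left hcs hn'.le
    _ = _ := by ring

theorem sum_sq_sub_mean (x : Fin n → ℝ) :
    ∑ i, (x i - mean x) ^ 2 = ∑ i, x i ^ 2 - n * mean x ^ 2 := by
  rcases Nat.eq_zero_or_pos n with rfl | hn
  · simp
  have hn' : (n : ℝ) ≠ 0 := by exact_mod_cast hn.ne'
  have hs : ∑ i, x i = n * mean x := by rw [mean, smul_eq_mul]; field_simp
  calc ∑ i, (x i - mean x) ^ 2 = ∑ i, (x i ^ 2 - 2 * mean x * x i + mean x ^ 2) :=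
        sum_congr rfl fun i _ => by ring
    _ = ∑ i, x i ^ 2 - 2 * mean x * ∑ i, x i + n * mean x ^ 2 := by
        rw [sum_add_distrib, sum_sub_distrib, ← mul_sum]; simp
    _ = _ := by rw [hs]; ring

theorem mean_mulVec {A : Matrix (Fin n) (Fin n) ℝ} (hA : A ∈ doublyStochastic ℝ (Fin n))
    (x : Fin n → ℝ) : mean (A *ᵥ x) = mean x := by
  rw [mean, mean, sum_mulVec_of_mem_doublyStochastic hA]

theorem variance_window_of_monotone {e : ℝ} (he : 0 ≤ e) {A : ℕ → Matrix (Fin n) (Fin n) ℝ}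
    (hA : ∀ t, IsAveraging e (A t)) {x : ℕ → Fin n → ℝ}
    (hx0 : Monotone (x 0)) (hx : ∀ t, x (t + 1) = A t *ᵥ x t) (T : ℕ)
    (hcross : ∀ S : Finset (Fin n), S.Nonempty → Sᶜ.Nonempty → ∃ t < T, Crosses (A t) S) :
    ∑ i, (x T i - mean (x T)) ^ 2 ≤
      (1 - e / (2 * (n : ℝ) ^ 2)) * ∑ i, (x 0 i - mean (x 0)) ^ 2 := by
  rcases Nat.eq_zero_or_pos n with rfl | hn
  · simp
  have hn' : (0 : ℝ) < n := by exact_mod_cast hn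
  -- The sorted values, continued constantly so as to be monotone on all of ℕ.
  set Y : ℕ → ℝ := fun k => x 0 ⟨min k (n - 1), by omega⟩ with hYdef
  have hY : Monotone Y := fun a b hab => hx0 (by
    rw [Fin.mk_le_mk]; omega)
  have hx0Y : ∀ i, x 0 i = Y i := fun i => by
    simp only [hYdef]
    congr 1
    ext
    simp only
    omega
  have hdec := sum_sq_decrease_window he hA hY hx0Y hx T (fun l hl => hcross _
    ⟨⟨0, hn⟩, mem_lowerCut.2 (Nat.zero_le _)⟩
    ⟨⟨l + 1, hl⟩, by rw [mem_compl, mem_lowerCut]; simp⟩)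
  have hvar := sum_sq_sub_mean_le hY hx0Y
  have hmeans : ∀ t, mean (x t) = mean (x 0) := fun t => by
    induction t with
    | zero => rfl
    | succ t ih => rw [hx, mean_mulVec (hA t).mem, ih]
  have hmean := hmeans T
  have h1 : e / (2 * (n : ℝ) ^ 2) * ∑ i, (x 0 i - mean (x 0)) ^ 2 ≤
      e / 2 * ∑ l ∈ range (n - 1), (Y (l + 1) - Y l) ^ 2 := by
    calc _ ≤ e / (2 * (n : ℝ) ^ 2) *
          ((n : ℝ) ^ 2 * ∑ l ∈ range (n - 1), (Y (l + 1) - Y l) ^ 2) :=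
          mul_le_mul_of_nonneg_left hvar (by positivity)
      _ = _ := by field_simp
  have h2 := sum_sq_sub_mean (x T)
  have h3 := sum_sq_sub_mean (x 0)
  rw [hmean] at h2
  rw [hmean]
  linarith

theorem IsAveraging.submatrix {e : ℝ} {A : Matrix (Fin n) (Fin n) ℝ} (hA : IsAveraging e A)
    (π : Equiv.Perm (Fin n)) : IsAveraging e (A.submatrix π π) where
  mem := by
    have := reindex_mem_doublyStochastic (e₁ := π.symm) (e₂ := π.symm) hA.mem
    simpa [Matrix.reindex_apply] using this
  diag i := hA.diag _
  entry i j := hA.entry _ _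

theorem variance_window {e : ℝ} (he : 0 ≤ e) {A : ℕ → Matrix (Fin n) (Fin n) ℝ}
    (hA : ∀ t, IsAveraging e (A t)) {x : ℕ → Fin n → ℝ}
    (hx : ∀ t, x (t + 1) = A t *ᵥ x t) (T : ℕ)
    (hcross : ∀ S : Finset (Fin n), S.Nonempty → Sᶜ.Nonempty → ∃ t < T, Crosses (A t) S) :
    ∑ i, (x T i - mean (x T)) ^ 2 ≤
      (1 - e / (2 * (n : ℝ) ^ 2)) * ∑ i, (x 0 i - mean (x 0)) ^ 2 := by
  -- Relabelling the agents sorts the initial values; the hypotheses and the variance are invariant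
  -- under it.
  set π := Tuple.sort (x 0) with hπ
  have hmean : ∀ y : Fin n → ℝ, mean (y ∘ π) = mean y := fun y => by
    simp only [mean, Function.comp_def]
    rw [Equiv.sum_comp π]
  have hsum : ∀ y : Fin n → ℝ,
      ∑ i, ((y ∘ π) i - mean (y ∘ π)) ^ 2 = ∑ i, (y i - mean y) ^ 2 := fun y => by
    rw [hmean]
    exact Equiv.sum_comp π (fun i => (y i - mean y) ^ 2)
  have := variance_window_of_monotone he (A := fun t => (A t).submatrix π π)
    (fun t => (hA t).submatrix π) (x := fun t => x t ∘ π) (Tuple.monotone_sort (x 0))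
    (fun t => by
      ext i
      simp only [hx, Function.comp_apply, mulVec, dotProduct, submatrix_apply]
      exact (Equiv.sum_comp π (fun j => A t (π i) j * x t j)).symm) T
    (fun S hS hS' => by
      obtain ⟨t, ht, i, hi, j, hj, h⟩ := hcross (S.map π.toEmbedding) (hS.map)
        (by
          obtain ⟨k, hk⟩ := hS'
          exact ⟨π k, by simpa using hk⟩)
      rw [mem_map_equiv] at hi hj
      exact ⟨t, ht, π.symm i, hi, π.symm j, hj, by simpa using h⟩)
  simpa only [hsum] using this

end Window

end Averaging

end CSPSG

namespace CSPSG

/-! ### Geometric decay of the disagreement, with and without disturbances. -/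

noncomputable section Mixing

open Matrix Finset

variable {N d : ℕ}

/-- Every agent replaces its vector by the combination with the weights in its row of `A`. -/
def mix {E : Type*} [AddCommGroup E] [Module ℝ E] (A : Matrix (Fin N) (Fin N) ℝ)
    (x : Fin N → E) : Fin N → E := fun i => ∑ j, A i j • x j

/-- The Euclidean norm of a finite family of vectors. -/
def famNorm {E : Type*} [NormedAddCommGroup E] (x : Fin N → E) : ℝ :=
  Real.sqrt (∑ i, ‖x i‖ ^ 2)

/-- The disagreement of a finite family of vectors: its distance from the consensus families. -/
def disagreement {E : Type*} [NormedAddCommGroup E] [Module ℝ E] (x : Fin N → E) : ℝ :=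
  famNorm fun i => x i - mean x

section Generic

variable {E : Type*} [NormedAddCommGroup E]

theorem famNorm_nonneg (x : Fin N → E) : 0 ≤ famNorm x := Real.sqrt_nonneg _

theorem famNorm_sq (x : Fin N → E) : famNorm x ^ 2 = ∑ i, ‖x i‖ ^ 2 :=
  Real.sq_sqrt (sum_nonneg fun _ _ => sq_nonneg _)

theorem famNorm_eq_norm (x : Fin N → E) : famNorm x = ‖WithLp.toLp 2 x‖ := by
  rw [PiLp.norm_eq_of_L2]; rfl

theorem famNorm_add_le (x y : Fin N → E) :
    famNorm (fun i => x i + y i) ≤ famNorm x + famNorm y := by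
  simp only [famNorm_eq_norm]
  exact norm_add_le (WithLp.toLp 2 x) (WithLp.toLp 2 y)

theorem famNorm_le_iff {x : Fin N → E} {a : ℝ} (ha : 0 ≤ a) :
    famNorm x ≤ a ↔ ∑ i, ‖x i‖ ^ 2 ≤ a ^ 2 := by
  rw [famNorm, Real.sqrt_le_left ha]

theorem famNorm_smul_le [NormedSpace ℝ E] {c : ℝ} (hc : 0 ≤ c) (x : Fin N → E) :
    famNorm (fun i => c • x i) = c * famNorm x := by
  rw [famNorm, famNorm]
  simp only [norm_smul, mul_pow, ← mul_sum]
  rw [Real.sqrt_mul (sq_nonneg _), Real.norm_of_nonneg hc, Real.sqrt_sq hc]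

theorem sum_inner_le_famNorm [InnerProductSpace ℝ E] (x y : Fin N → E) :
    ∑ i, inner ℝ (x i) (y i) ≤ famNorm x * famNorm y := by
  calc ∑ i, inner ℝ (x i) (y i) ≤ ∑ i, ‖x i‖ * ‖y i‖ :=
        sum_le_sum fun i _ => real_inner_le_norm _ _
    _ ≤ _ := Real.sum_mul_le_sqrt_mul_sqrt _ _ _

variable [NormedSpace ℝ E]

theorem disagreement_nonneg (x : Fin N → E) : 0 ≤ disagreement x := famNorm_nonneg _

theorem mean_add (x y : Fin N → E) : mean (fun i => x i + y i) = mean x + mean y := by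
  simp only [mean, sum_add_distrib, smul_add]

theorem mean_smul (c : ℝ) (x : Fin N → E) : mean (fun i => c • x i) = c • mean x := by
  simp only [mean, ← smul_sum]
  rw [smul_comm]

theorem disagreement_add_le (x y : Fin N → E) :
    disagreement (fun i => x i + y i) ≤ disagreement x + disagreement y := by
  refine le_trans (le_of_eq ?_) (famNorm_add_le _ _)
  rw [disagreement]
  congr 1
  ext i
  rw [mean_add]
  abel

theorem disagreement_smul {c : ℝ} (hc : 0 ≤ c) (x : Fin N → E) :
    disagreement (fun i => c • x i) = c * disagreement x := by
  rw [disagreement, disagreement, ← famNorm_smul_le hc]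
  congr 1
  ext i
  rw [mean_smul, smul_sub]

theorem mean_mix {A : Matrix (Fin N) (Fin N) ℝ} (hA : A ∈ doublyStochastic ℝ (Fin N))
    (x : Fin N → E) : mean (mix A x) = mean x := by
  simp only [mean, mix]
  congr 1
  rw [sum_comm]
  exact sum_congr rfl fun j _ => by
    rw [← sum_smul, sum_col_of_mem_doublyStochastic hA, one_smul]

theorem mix_add (A : Matrix (Fin N) (Fin N) ℝ) (x y : Fin N → E) :
    mix A (x + y) = mix A x + mix A y := by
  ext i
  simp [mix, smul_add, sum_add_distrib]

/-- Jensen for the squared norm along each row, then unit column sums. -/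
theorem sum_norm_mix_sub_sq_le {A : Matrix (Fin N) (Fin N) ℝ}
    (hA : A ∈ doublyStochastic ℝ (Fin N)) (x : Fin N → E) (p : E) :
    ∑ i, ‖mix A x i - p‖ ^ 2 ≤ ∑ i, ‖x i - p‖ ^ 2 := by
  have hrow := fun i => sum_row_of_mem_doublyStochastic hA i
  have hcv : ConvexOn ℝ Set.univ fun v : E => ‖v‖ ^ 2 :=
    (convexOn_norm convex_univ).pow (fun _ _ => norm_nonneg _) 2
  calc ∑ i, ‖mix A x i - p‖ ^ 2 ≤ ∑ i, ∑ j, A i j * ‖x j - p‖ ^ 2 := by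
        refine sum_le_sum fun i _ => ?_
        have : mix A x i - p = ∑ j, A i j • (x j - p) := by
          simp only [mix, smul_sub, sum_sub_distrib]
          rw [← sum_smul, hrow, one_smul]
        rw [this]
        exact hcv.map_sum_le (fun j _ => hA.1 i j) (hrow i) fun _ _ => Set.mem_univ _
    _ = ∑ j, ‖x j - p‖ ^ 2 := by
        rw [sum_comm]
        exact sum_congr rfl fun j _ => by
          rw [← sum_mul, sum_col_of_mem_doublyStochastic hA, one_mul]

theorem disagreement_mix_le {A : Matrix (Fin N) (Fin N) ℝ}
    (hA : A ∈ doublyStochastic ℝ (Fin N)) (x : Fin N → E) :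
    disagreement (mix A x) ≤ disagreement x := by
  rw [disagreement, disagreement, mean_mix hA]
  exact Real.sqrt_le_sqrt (sum_norm_mix_sub_sq_le hA x _)

end Generic

/-- Pythagoras: subtracting the mean removes N ‖mean‖² from the sum of squares. -/
theorem disagreement_le_famNorm {E : Type*} [NormedAddCommGroup E] [InnerProductSpace ℝ E]
    (x : Fin N → E) : disagreement x ≤ famNorm x := by
  refine Real.sqrt_le_sqrt ?_
  rcases Nat.eq_zero_or_pos N with rfl | hN
  · simp
  have hN' : (N : ℝ) ≠ 0 := by exact_mod_cast hN.ne'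
  have hs : ∑ i, x i = (N : ℝ) • mean x := by rw [mean, smul_smul, mul_inv_cancel₀ hN', one_smul]
  have h : ∑ i, ‖x i - mean x‖ ^ 2 = ∑ i, ‖x i‖ ^ 2 - N * ‖mean x‖ ^ 2 := by
    simp only [norm_sub_sq_real, sum_add_distrib, sum_sub_distrib, ← mul_sum]
    rw [← sum_inner, hs, inner_smul_left, real_inner_self_eq_norm_sq]
    simp
    ring
  rw [h]
  have : 0 ≤ (N : ℝ) * ‖mean x‖ ^ 2 := by positivity
  linarith

/-- The families obtained from `x` at time `s` by `k` steps of mixing with `A s, A (s + 1), …`. -/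
def flow {E : Type*} [AddCommGroup E] [Module ℝ E] (A : ℕ → Matrix (Fin N) (Fin N) ℝ) (s : ℕ) :
    ℕ → (Fin N → E) → Fin N → E
  | 0, x => x
  | k + 1, x => mix (A (s + k)) (flow A s k x)

section Flow

variable {E : Type*} [NormedAddCommGroup E] [NormedSpace ℝ E]
  {A : ℕ → Matrix (Fin N) (Fin N) ℝ}

theorem flow_add_vec (s k : ℕ) (x y : Fin N → E) :
    flow A s k (x + y) = flow A s k x + flow A s k y := by
  induction k with
  | zero => rfl
  | succ k ih => rw [flow, ih, mix_add]; rfl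

theorem flow_add_steps (s a b : ℕ) (x : Fin N → E) :
    flow A s (a + b) x = flow A (s + a) b (flow A s a x) := by
  induction b with
  | zero => rfl
  | succ b ih => rw [← add_assoc, flow, ih, flow, add_assoc]

theorem flow_succ' (s k : ℕ) (x : Fin N → E) :
    flow A s (k + 1) x = flow A (s + 1) k (mix (A s) x) := by
  rw [add_comm, flow_add_steps]; rfl

theorem disagreement_flow_le (hA : ∀ t, 1 ≤ t → A t ∈ doublyStochastic ℝ (Fin N)) {s : ℕ}
    (hs : 1 ≤ s) (k : ℕ) (x : Fin N → E) : disagreement (flow A s k x) ≤ disagreement x := by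
  induction k with
  | zero => exact le_rfl
  | succ k ih => exact (disagreement_mix_le (hA _ (by omega)) _).trans ih

end Flow

theorem disagreement_sq (x : Fin N → EuclideanSpace ℝ (Fin d)) :
    disagreement x ^ 2 =
      ∑ l, ∑ i, (x i l - mean fun i => x i l) ^ 2 := by
  rw [disagreement, famNorm_sq, sum_comm]
  refine sum_congr rfl fun i _ => ?_
  rw [EuclideanSpace.real_norm_sq_eq]
  refine sum_congr rfl fun l _ => ?_
  simp [mean]

theorem mix_apply_coord (A : Matrix (Fin N) (Fin N) ℝ) (x : Fin N → EuclideanSpace ℝ (Fin d))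
    (i : Fin N) (l : Fin d) : mix A x i l = (A *ᵥ fun j => x j l) i := by
  simp [mix, mulVec, dotProduct]

/-- Every cut is crossed within the window of `B` steps from time `s`. -/
def WindowConnected (A : ℕ → Matrix (Fin N) (Fin N) ℝ) (s B : ℕ) : Prop :=
  ∀ S : Finset (Fin N), S.Nonempty → Sᶜ.Nonempty → ∃ t < B, Crosses (A (s + t)) S

/-- The contraction factor of the disagreement over a window. -/
def windowFactor (N : ℕ) (e : ℝ) : ℝ := 1 - e / (4 * (N : ℝ) ^ 2)

theorem windowFactor_lt_one {e : ℝ} (hN : 1 ≤ N) (he : 0 < e) : windowFactor N e < 1 := by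
  have : (0 : ℝ) < N := by exact_mod_cast hN
  rw [windowFactor, sub_lt_self_iff]
  positivity

theorem three_quarters_le_windowFactor {e : ℝ} (hN : 1 ≤ N) (he1 : e ≤ 1) :
    3 / 4 ≤ windowFactor N e := by
  have : (1 : ℝ) ≤ N := by exact_mod_cast hN
  have : e / (4 * (N : ℝ) ^ 2) ≤ 1 / 4 := by
    rw [div_le_div_iff₀ (by positivity) (by norm_num)]
    nlinarith
  rw [windowFactor]; linarith

variable {e : ℝ} {A : ℕ → Matrix (Fin N) (Fin N) ℝ}

theorem disagreement_window (hN : 1 ≤ N) (he : 0 ≤ e) (he1 : e ≤ 1)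
    (hA : ∀ t, 1 ≤ t → IsAveraging e (A t)) {s B : ℕ} (hs : 1 ≤ s) (hc : WindowConnected A s B)
    (x : Fin N → EuclideanSpace ℝ (Fin d)) :
    disagreement (flow A s B x) ≤ windowFactor N e * disagreement x := by
  have hN' : (1 : ℝ) ≤ N := by exact_mod_cast hN
  have hq := three_quarters_le_windowFactor hN he1
  refine le_of_sq_le_sq ?_ (mul_nonneg (by linarith) (disagreement_nonneg x))
  -- The variance is a square, so taking the root halves the loss: hence 4 N² in place of 2 N².
  have hfac : 1 - e / (2 * (N : ℝ) ^ 2) ≤ windowFactor N e ^ 2 := by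
    have h : e / (2 * (N : ℝ) ^ 2) = 2 * (e / (4 * (N : ℝ) ^ 2)) := by field_simp; ring
    rw [windowFactor, h]
    nlinarith [sq_nonneg (e / (4 * (N : ℝ) ^ 2))]
  rw [mul_pow, disagreement_sq, disagreement_sq, mul_sum]
  refine sum_le_sum fun l _ => ?_
  refine (variance_window he (A := fun t => A (s + t)) (fun t => hA _ (by omega))
    (x := fun t i => flow A s t x i l) (fun t => ?_) B hc).trans ?_
  · ext i
    exact mix_apply_coord _ _ _ _
  · exact mul_le_mul_of_nonneg_right hfac (sum_nonneg fun _ _ => sq_nonneg _)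

theorem disagreement_windows (hN : 1 ≤ N) (he : 0 ≤ e) (he1 : e ≤ 1)
    (hA : ∀ t, 1 ≤ t → IsAveraging e (A t)) {B : ℕ} (hB : 1 ≤ B)
    (hc : ∀ k, 1 ≤ k → WindowConnected A (k * B) B) {k : ℕ} (hk : 1 ≤ k) (n : ℕ)
    (x : Fin N → EuclideanSpace ℝ (Fin d)) :
    disagreement (flow A (k * B) (n * B) x) ≤ windowFactor N e ^ n * disagreement x := by
  induction n with
  | zero => simp [flow]
  | succ n ih =>
    have hq := three_quarters_le_windowFactor hN he1
    rw [add_mul, one_mul, flow_add_steps, ← add_mul]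
    refine (disagreement_window hN he he1 hA (by nlinarith) (hc _ (by omega)) _).trans ?_
    rw [pow_succ', mul_assoc]
    exact mul_le_mul_of_nonneg_left ih (by linarith)

/-- The contraction factor of the disagreement per step. -/
def stepFactor (N B : ℕ) (e : ℝ) : ℝ := windowFactor N e ^ (1 / (B : ℝ))

theorem stepFactor_pos {B : ℕ} (hN : 1 ≤ N) (he1 : e ≤ 1) : 0 < stepFactor N B e :=
  Real.rpow_pos_of_pos (by linarith [three_quarters_le_windowFactor hN he1]) _

theorem stepFactor_lt_one {B : ℕ} (hB : 1 ≤ B) (hN : 1 ≤ N) (he : 0 < e) (he1 : e ≤ 1) :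
    stepFactor N B e < 1 :=
  Real.rpow_lt_one (by linarith [three_quarters_le_windowFactor hN he1])
    (windowFactor_lt_one hN he) (by positivity)

theorem stepFactor_pow {B : ℕ} (hB : 1 ≤ B) (hN : 1 ≤ N) (he1 : e ≤ 1) :
    stepFactor N B e ^ B = windowFactor N e := by
  rw [stepFactor, ← Real.rpow_natCast, ← Real.rpow_mul
    (by linarith [three_quarters_le_windowFactor hN he1]), one_div_mul_cancel
    (by positivity), Real.rpow_one]

/-- Only complete windows contract. The incomplete ones at the two ends waste fewer than 2B steps,
and the factor 16/9 = (4/3)² pays for them because the window factor is at least 3/4. -/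
theorem disagreement_flow_le_geometric (hN : 1 ≤ N) (he : 0 < e) (he1 : e ≤ 1)
    (hA : ∀ t, 1 ≤ t → IsAveraging e (A t)) {B : ℕ} (hB : 1 ≤ B)
    (hc : ∀ k, 1 ≤ k → WindowConnected A (k * B) B) {s : ℕ} (hs : 1 ≤ s) (K : ℕ)
    (x : Fin N → EuclideanSpace ℝ (Fin d)) :
    disagreement (flow A s K x) ≤ 16 / 9 * stepFactor N B e ^ K * disagreement x := by
  have hmono : ∀ {s : ℕ}, 1 ≤ s → ∀ k (x : Fin N → EuclideanSpace ℝ (Fin d)),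
      disagreement (flow A s k x) ≤ disagreement x := fun hs k x =>
    disagreement_flow_le (fun t ht => (hA t ht).mem) hs k x
  have hq := three_quarters_le_windowFactor hN he1
  have hρ := stepFactor_pos (B := B) hN he1
  have hρ1 := (stepFactor_lt_one hB hN he he1).le
  have hρB := stepFactor_pow hB hN he1
  set ρ := stepFactor N B e
  set q := windowFactor N e
  have hρ2B : ∀ a, a ≤ 2 * B → 1 ≤ 16 / 9 * ρ ^ a := fun a ha => by
    have h1 : ρ ^ (2 * B) ≤ ρ ^ a := pow_le_pow_of_le_one hρ.le hρ1 ha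
    rw [mul_comm 2 B, pow_mul, hρB] at h1
    nlinarith
  obtain ⟨k, c, hk, hkc, hcB⟩ : ∃ k c, 1 ≤ k ∧ s + c = k * B ∧ c < B := by
    refine ⟨(s + (B - 1)) / B, (s + (B - 1)) / B * B - s, ?_, ?_, ?_⟩
    · exact (Nat.one_le_div_iff (by omega)).2 (by omega)
    all_goals
      have h1 := Nat.div_add_mod (s + (B - 1)) B
      have h2 := Nat.mod_lt (s + (B - 1)) (show 0 < B by omega)
      rw [mul_comm] at h1
      omega
  by_cases hK : K < c
  · refine (hmono hs K x).trans ?_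
    nlinarith [hρ2B K (by omega), disagreement_nonneg x]
  · obtain ⟨n, r, hr, hKn⟩ : ∃ n r, r < B ∧ K = c + (n * B + r) := by
      refine ⟨(K - c) / B, (K - c) % B, Nat.mod_lt _ (by omega), ?_⟩
      have h1 := Nat.div_add_mod (K - c) B
      rw [mul_comm] at h1
      omega
    rw [hKn, flow_add_steps, flow_add_steps, hkc]
    refine (hmono (by nlinarith) _ _).trans ?_
    refine (disagreement_windows hN he.le he1 hA hB hc hk n _).trans ?_
    have hqn : 0 ≤ q ^ n := pow_nonneg (by linarith) n
    have hd := hmono hs c x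
    have h0 := disagreement_nonneg x
    have hpow : ρ ^ (c + (n * B + r)) = q ^ n * ρ ^ (c + r) := by
      rw [← hρB, ← pow_mul, ← pow_add]; congr 1; ring
    rw [hpow]
    calc q ^ n * disagreement (flow A s c x) ≤ q ^ n * disagreement x :=
          mul_le_mul_of_nonneg_left hd hqn
      _ ≤ q ^ n * disagreement x * (16 / 9 * ρ ^ (c + r)) :=
          le_mul_of_one_le_right (mul_nonneg hqn h0) (hρ2B _ (by omega))
      _ = _ := by ring

/-- By linearity of the flow, the sequence is the transported initial family plus the disturbances,
each transported from the time it occurs. -/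
theorem disagreement_perturbed (hN : 1 ≤ N) (he : 0 < e) (he1 : e ≤ 1)
    (hA : ∀ t, 1 ≤ t → IsAveraging e (A t)) {B : ℕ} (hB : 1 ≤ B)
    (hc : ∀ k, 1 ≤ k → WindowConnected A (k * B) B)
    (x : ℕ → Fin N → EuclideanSpace ℝ (Fin d)) {U : ℝ} (K : ℕ) {s : ℕ} (hs : 1 ≤ s)
    (hU : ∀ t, s ≤ t → t < s + K → famNorm (fun i => x (t + 1) i - mix (A t) (x t) i) ≤ U) :
    disagreement (x (s + K)) ≤
      16 / 9 * (stepFactor N B e ^ K * disagreement (x s) +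
        ∑ i ∈ range K, stepFactor N B e ^ i * U) := by
  have hρ := stepFactor_pos (B := B) hN he1
  set ρ := stepFactor N B e with hρdef
  have main : ∀ K s, 1 ≤ s →
      (∀ t, s ≤ t → t < s + K → famNorm (fun i => x (t + 1) i - mix (A t) (x t) i) ≤ U) →
      disagreement (fun i => x (s + K) i - flow A s K (x s) i) ≤
        16 / 9 * ∑ i ∈ range K, ρ ^ i * U := by
    intro K
    induction K with
    | zero =>
      intro s _ _
      simp [disagreement, famNorm, flow, mean]
    | succ K ih =>
      intro s hs hU
      set u : Fin N → EuclideanSpace ℝ (Fin d) := fun i => x (s + 1) i - mix (A s) (x s) i with hu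
      -- Peel off the earliest disturbance, which is mixed for the remaining K steps and so yields
      -- the last term of the series.
      have hsplit : (fun i => x (s + (K + 1)) i - flow A s (K + 1) (x s) i) =
          fun i => (x (s + 1 + K) i - flow A (s + 1) K (x (s + 1)) i) +
            flow A (s + 1) K u i := by
        have hx : x (s + 1) = mix (A s) (x s) + u := by ext1 i; simp [hu]
        ext1 i
        rw [flow_succ', hx, flow_add_vec, add_right_comm s 1 K, add_assoc s K 1,
          Pi.add_apply]
        abel
      rw [hsplit]
      refine (disagreement_add_le _ _).trans ?_
      rw [sum_range_succ, mul_add]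
      refine add_le_add (ih (s + 1) (by omega) fun t h1 h2 => hU t (by omega) (by omega)) ?_
      refine (disagreement_flow_le_geometric hN he he1 hA hB hc (by omega) K u).trans ?_
      rw [mul_assoc, ← hρdef]
      have h1 : disagreement u ≤ U :=
        (disagreement_le_famNorm u).trans (hU s le_rfl (by omega))
      have h2 := mul_le_mul_of_nonneg_left h1 (pow_pos hρ K).le
      linarith
  have hsplit : x (s + K) =
      fun i => flow A s K (x s) i + (x (s + K) i - flow A s K (x s) i) := by ext1 i; simp
  rw [hsplit]
  refine (disagreement_add_le _ _).trans ?_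
  have h1 := disagreement_flow_le_geometric hN he he1 hA hB hc hs K (x s)
  have h2 := main K s hs hU
  rw [← hρdef] at h1
  change disagreement (flow A s K (x s)) + _ ≤ _
  linarith

/-- The initial disagreement contributes one geometric series over the whole stretch, and the
disturbances at most one series per time. Half of 2⁵/3² is the 16/9 of the decay estimate. -/
theorem sum_disagreement_perturbed (hN : 1 ≤ N) (he : 0 < e) (he1 : e ≤ 1)
    (hA : ∀ t, 1 ≤ t → IsAveraging e (A t)) {B : ℕ} (hB : 1 ≤ B)
    (hc : ∀ k, 1 ≤ k → WindowConnected A (k * B) B)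
    (x : ℕ → Fin N → EuclideanSpace ℝ (Fin d)) {U : ℝ} (hU0 : 0 ≤ U) (M : ℕ) {s : ℕ} (hs : 1 ≤ s)
    (hU : ∀ t, s ≤ t → t < s + M → famNorm (fun i => x (t + 1) i - mix (A t) (x t) i) ≤ U) :
    ∑ t ∈ Ico s (s + M), disagreement (x t) ≤ Cu N B e / 2 * (disagreement (x s) + M * U) := by
  have hρ := stepFactor_pos (B := B) hN he1
  have hρ1 := stepFactor_lt_one hB hN he he1
  have hCu : Cu N B e / 2 = 16 / 9 * (1 - stepFactor N B e)⁻¹ := by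
    rw [Cu, stepFactor, windowFactor]; ring
  rw [hCu]
  set ρ := stepFactor N B e with hρdef
  have hgeo : ∀ K, ∑ i ∈ range K, ρ ^ i ≤ (1 - ρ)⁻¹ := fun K => by
    rw [← tsum_geometric_of_lt_one hρ.le hρ1]
    exact (summable_geometric_of_lt_one hρ.le hρ1).sum_le_tsum _ fun i _ => (pow_pos hρ i).le
  rw [sum_Ico_eq_sum_range, add_tsub_cancel_left]
  have hpt : ∀ K ∈ range M, disagreement (x (s + K)) ≤
      16 / 9 * (ρ ^ K * disagreement (x s) + (1 - ρ)⁻¹ * U) := fun K hK => by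
    have hK' := mem_range.1 hK
    have h := disagreement_perturbed hN he he1 hA hB hc x (U := U) K hs
      fun t h1 h2 => hU t h1 (by omega)
    rw [← hρdef, ← sum_mul] at h
    have := mul_le_mul_of_nonneg_right (hgeo K) hU0
    linarith
  refine (sum_le_sum hpt).trans ?_
  rw [← mul_sum, sum_add_distrib, ← sum_mul, sum_const, card_range, nsmul_eq_mul]
  have := mul_le_mul_of_nonneg_right (hgeo M) (disagreement_nonneg (x s))
  rw [mul_assoc]
  refine mul_le_mul_of_nonneg_left ?_ (by norm_num)
  linarith

end Mixing

end CSPSG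

namespace CSPSG

/-! ### From digraphs and stepsizes to averaging matrices. -/

noncomputable section Graphs

open Matrix Finset

variable {N d : ℕ}

/-- In an eigenbasis of T*T the squared norm of T v is weighted by the squared singular values, all
bounded by the one of index zero. -/
theorem norm_le_singularValues_zero {E F : Type*} [NormedAddCommGroup E] [InnerProductSpace ℝ E]
    [FiniteDimensional ℝ E] [NormedAddCommGroup F] [InnerProductSpace ℝ F] [FiniteDimensional ℝ F]
    (T : E →ₗ[ℝ] F) (v : E) : ‖T v‖ ≤ T.singularValues 0 * ‖v‖ := by
  refine le_of_sq_le_sq ?_ (mul_nonneg (T.singularValues_nonneg 0) (norm_nonneg v))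
  set n := Module.finrank ℝ E with hn
  have hT := T.isSymmetric_adjoint_comp_self
  set b := hT.eigenvectorBasis hn.symm with hb
  have h1 : ‖T v‖ ^ 2 = ∑ i, hT.eigenvalues hn.symm i * (b.repr v i) ^ 2 := by
    have : ‖T v‖ ^ 2 = inner ℝ ((LinearMap.adjoint T ∘ₗ T) v) v := by
      rw [LinearMap.comp_apply, LinearMap.adjoint_inner_left, real_inner_self_eq_norm_sq]
    rw [this, ← b.repr.inner_map_map, PiLp.inner_apply]
    refine sum_congr rfl fun i _ => ?_
    rw [hT.eigenvectorBasis_apply_self_apply]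
    simp
    ring
  have h2 : ‖v‖ ^ 2 = ∑ i, (b.repr v i) ^ 2 := by
    rw [← b.repr.norm_map, EuclideanSpace.real_norm_sq_eq]
  rw [mul_pow, h1, h2, mul_sum]
  refine sum_le_sum fun i _ => mul_le_mul_of_nonneg_right ?_ (sq_nonneg _)
  rw [← T.sq_singularValues_fin hn.symm i]
  exact pow_le_pow_left₀ (T.singularValues_nonneg _) (T.singularValues_antitone (Nat.zero_le _)) 2

theorem maxSingularValue_nonneg (A : Matrix (Fin N) (Fin N) ℝ) : 0 ≤ maxSingularValue A :=
  LinearMap.singularValues_nonneg _ _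

theorem famNorm_mix_le (A : Matrix (Fin N) (Fin N) ℝ) (x : Fin N → EuclideanSpace ℝ (Fin d)) :
    famNorm (mix A x) ≤ maxSingularValue A * famNorm x := by
  refine le_of_sq_le_sq ?_ (mul_nonneg (maxSingularValue_nonneg A) (famNorm_nonneg x))
  rw [mul_pow, famNorm_sq, famNorm_sq]
  simp only [EuclideanSpace.real_norm_sq_eq]
  rw [sum_comm, sum_comm (f := fun i l => x i l ^ 2), mul_sum]
  refine sum_le_sum fun l _ => ?_
  have h := norm_le_singularValues_zero (Matrix.toEuclideanLin A) (WithLp.toLp 2 fun i => x i l)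
  have h' := pow_le_pow_left₀ (norm_nonneg _) h 2
  rw [mul_pow, EuclideanSpace.real_norm_sq_eq, EuclideanSpace.real_norm_sq_eq] at h'
  refine le_trans (le_of_eq ?_) h'
  exact sum_congr rfl fun i _ => by rw [mix_apply_coord]; rfl

namespace WeightedDigraph

/-- The averaging matrix `1 - σ L`. -/
def averagingMatrix (σ : ℝ) (G : WeightedDigraph N) : Matrix (Fin N) (Fin N) ℝ :=
  1 - σ • G.laplacian

theorem mix_laplacian (G : WeightedDigraph N) {E : Type*} [NormedAddCommGroup E] [NormedSpace ℝ E]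
    (x : Fin N → E) (i : Fin N) :
    mix G.laplacian x i = -∑ j, G.weight i j • (x j - x i) := by
  simp only [mix, laplacian, Matrix.sub_apply, sub_smul, smul_sub, sum_sub_distrib, diagonal_apply,
    ite_smul, zero_smul, sum_ite_eq, mem_univ, if_true, outDegree, sum_smul]
  abel

theorem mix_averagingMatrix (σ : ℝ) (G : WeightedDigraph N) {E : Type*} [NormedAddCommGroup E]
    [NormedSpace ℝ E] (x : Fin N → E) (i : Fin N) :
    mix (G.averagingMatrix σ) x i = x i + σ • ∑ j, G.weight i j • (x j - x i) := by
  have h : mix (G.averagingMatrix σ) x i = x i - σ • mix G.laplacian x i := by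
    simp [mix, averagingMatrix, sub_smul, Matrix.one_apply, mul_smul, smul_sum]
  rw [h, mix_laplacian]
  simp

/-- The Laplacian sees only differences, so the mean may be subtracted first. -/
theorem famNorm_mix_laplacian_le (G : WeightedDigraph N) (x : Fin N → EuclideanSpace ℝ (Fin d)) :
    famNorm (mix G.laplacian x) ≤ maxSingularValue G.laplacian * disagreement x := by
  refine le_trans (le_of_eq ?_) (famNorm_mix_le _ _)
  congr 1
  ext1 i
  rw [mix_laplacian, mix_laplacian]
  simp

variable {σ e δ dmax : ℝ} {G : WeightedDigraph N}

/-- Weight balance gives the unit column sums. The upper bound on σ secures the diagonal, the lower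
bound the positive off-diagonal entries; self-loops only enlarge the diagonal. -/
theorem isAveraging_averagingMatrix (hσ : 0 ≤ σ) (he : 0 ≤ e) (hbal : G.WeightBalanced)
    (hdeg : ∀ i, e ≤ 1 - σ * G.outDegree i) (hentry : ∀ i j, 0 < G.weight i j → δ < G.weight i j)
    (hδ : e ≤ σ * δ) : IsAveraging e (G.averagingMatrix σ) := by
  have hoff : ∀ i j, i ≠ j → G.averagingMatrix σ i j = σ * G.weight i j := fun i j h => by
    simp [averagingMatrix, laplacian, Matrix.one_apply_ne h, diagonal_apply_ne _ h]
  have hdiag : ∀ i, G.averagingMatrix σ i i = 1 - σ * G.outDegree i + σ * G.weight i i :=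
    fun i => by simp [averagingMatrix, laplacian]; ring
  have hdiag' : ∀ i, e ≤ G.averagingMatrix σ i i := fun i => by
    rw [hdiag]
    have := mul_nonneg hσ (G.weight_nonneg i i)
    linarith [hdeg i]
  refine ⟨mem_doublyStochastic_iff_sum.2 ⟨fun i j => ?_, fun i => ?_, fun j => ?_⟩, hdiag', ?_⟩
  · by_cases h : i = j
    · subst h; exact he.trans (hdiag' i)
    · rw [hoff i j h]; exact mul_nonneg hσ (G.weight_nonneg i j)
  · simp only [averagingMatrix, laplacian, Matrix.sub_apply, Matrix.smul_apply, smul_eq_mul, sum_sub_distrib,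
      ← mul_sum, Matrix.one_apply, diagonal_apply, sum_ite_eq, mem_univ, if_true]
    simp [outDegree]
  · simp only [averagingMatrix, laplacian, Matrix.sub_apply, Matrix.smul_apply, smul_eq_mul, sum_sub_distrib,
      ← mul_sum, Matrix.one_apply, diagonal_apply, sum_ite_eq', mem_univ, if_true]
    rw [hbal j]
    simp [inDegree]
  · intro i j h
    by_cases hij : i = j
    · subst hij; exact hdiag' i
    · rw [hoff i j hij] at h ⊢
      have hpos : 0 < G.weight i j :=
        lt_of_le_of_ne (G.weight_nonneg i j) fun h0 => h (by rw [← h0, mul_zero])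
      exact hδ.trans (mul_le_mul_of_nonneg_left (hentry i j hpos).le hσ)

theorem StronglyConnected.exists_edge {H : WeightedDigraph N} (hH : H.StronglyConnected)
    {S : Finset (Fin N)} (hS : S.Nonempty) (hS' : Sᶜ.Nonempty) :
    ∃ i ∈ S, ∃ j, j ∉ S ∧ H.Edge i j := by
  obtain ⟨a, ha⟩ := hS
  obtain ⟨b, hb⟩ := hS'
  rw [mem_compl] at hb
  have hab : a ≠ b := fun h => hb (h ▸ ha)
  by_contra hno
  push Not at hno
  have hstay : ∀ c, Relation.TransGen H.Edge a c → c ∈ S := fun c hc => by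
    induction hc with
    | single h => by_contra hc; exact hno a ha _ hc h
    | tail _ h ih => by_contra hc; exact hno _ ih _ hc h
  exact hb (hstay b (hH a b hab))

theorem windowConnected_averagingMatrix {G : ℕ → WeightedDigraph N} {B k : ℕ}
    (hσ : 0 < σ)
    (hc : (unionOver G (Finset.Ico (k * B) ((k + 1) * B))).StronglyConnected) :
    WindowConnected (fun t => (G t).averagingMatrix σ) (k * B) B := by
  intro S hS hS'
  obtain ⟨i, hi, j, hj, hij⟩ := hc.exists_edge hS hS'
  have hij' : 0 < ∑ t ∈ Finset.Ico (k * B) ((k + 1) * B), (G t).weight i j := hij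
  obtain ⟨t, ht, htpos⟩ := (sum_pos_iff_of_nonneg fun t _ => (G t).weight_nonneg i j).1 hij'
  rw [mem_Ico, add_mul, one_mul] at ht
  refine ⟨t - k * B, by omega, i, hi, j, hj, Or.inl ?_⟩
  have hne : i ≠ j := fun h => hj (h ▸ hi)
  have : k * B + (t - k * B) = t := by omega
  simp only [this, averagingMatrix, laplacian, Matrix.sub_apply, Matrix.smul_apply, Matrix.one_apply_ne hne,
    diagonal_apply_ne _ hne, zero_sub, smul_eq_mul, mul_neg, neg_neg]
  positivity

theorem outDegree_nonneg (G : WeightedDigraph N) (i : Fin N) : 0 ≤ G.outDegree i :=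
  sum_nonneg fun j _ => G.weight_nonneg i j

end WeightedDigraph

section Stepsize

variable {σ δ δ' dmax : ℝ}

theorem tildeDelta_pos (hδ : 0 < δ) (hδ'_pos : 0 < δ') (hδ'_lt : δ' < 1) (hd : 0 ≤ dmax) :
    0 < tildeDelta δ' δ dmax := by
  rw [tildeDelta]
  split_ifs with h
  · exact hδ'_pos
  · have : 0 < dmax := lt_of_le_of_ne hd (Ne.symm h)
    have : 0 < 1 - δ' := by linarith
    exact lt_min hδ'_pos (by positivity)

theorem tildeDelta_le : tildeDelta δ' δ dmax ≤ δ' := by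
  rw [tildeDelta]
  split_ifs
  · exact le_rfl
  · exact min_le_left _ _

theorem StepsizeCond.mul_le {e a : ℝ} (h : StepsizeCond σ e δ dmax) (hσ : 0 ≤ σ) (he : e ≤ 1)
    (ha : 0 ≤ a) (had : a ≤ dmax) : e ≤ 1 - σ * a := by
  by_cases hd : dmax = 0
  · have : a = 0 := le_antisymm (hd ▸ had) ha
    rw [this]; linarith
  · have hd' : 0 < dmax := lt_of_le_of_ne (ha.trans had) (Ne.symm hd)
    have := (le_div_iff₀ hd').1 (h.2 hd)
    nlinarith

end Stepsize

end Graphs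

end CSPSG

namespace CSPSG

/-! ### Projected subgradient steps, the doubling trick and consensus regret. -/

noncomputable section Regret

open Finset

section Projection

variable {E : Type*} [NormedAddCommGroup E] [InnerProductSpace ℝ E] {S : Set E}

theorem IsOrthProj.inner_le_zero (hS : Convex ℝ S) {x p : E} (h : IsOrthProj S x p) {y : E}
    (hy : y ∈ S) : inner ℝ (x - p) (y - p) ≤ 0 := by
  refine (norm_eq_iInf_iff_real_inner_le_zero hS h.1).1 ?_ y hy
  have : Nonempty S := ⟨⟨p, h.1⟩⟩
  exact le_antisymm (le_ciInf fun w => h.2 w w.2)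
    (ciInf_le ⟨0, by rintro _ ⟨w, rfl⟩; exact norm_nonneg _⟩ (⟨p, h.1⟩ : S))

theorem IsOrthProj.two_mul_inner_le (hS : Convex ℝ S) {y ξ p x' : E} {η : ℝ}
    (h : IsOrthProj S (y - η • ξ) x') (hp : p ∈ S) :
    2 * η * inner ℝ ξ (y - p) ≤ ‖y - p‖ ^ 2 - ‖x' - p‖ ^ 2 + η ^ 2 * ‖ξ‖ ^ 2 := by
  have h1 := h.inner_le_zero hS hp
  have h2 : ‖(y - η • ξ) - p‖ ^ 2 = ‖y - p‖ ^ 2 - 2 * η * inner ℝ ξ (y - p) + η ^ 2 * ‖ξ‖ ^ 2 := by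
    rw [sub_right_comm, norm_sub_sq_real, inner_smul_right, norm_smul, mul_pow, Real.norm_eq_abs,
      sq_abs, real_inner_comm]
    ring
  have h3 : ‖(y - η • ξ) - p‖ ^ 2 = ‖(y - η • ξ) - x'‖ ^ 2
      - 2 * inner ℝ ((y - η • ξ) - x') (p - x') + ‖x' - p‖ ^ 2 := by
    rw [← norm_sub_rev p x', ← norm_sub_sq_real, sub_sub_sub_cancel_right]
  nlinarith [sq_nonneg ‖(y - η • ξ) - x'‖]

/-- The variational inequality at y itself, with Cauchy–Schwarz. It bounds the disturbance that a
gradient step and its projection inflict on pure averaging. -/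
theorem IsOrthProj.norm_sub_le (hS : Convex ℝ S) {y ξ x' : E} {η : ℝ} (hη : 0 ≤ η)
    (h : IsOrthProj S (y - η • ξ) x') (hy : y ∈ S) : ‖x' - y‖ ≤ η * ‖ξ‖ := by
  have h1 := h.inner_le_zero hS hy
  have h2 : (y - η • ξ) - x' = (y - x') - η • ξ := by abel
  rw [h2, inner_sub_left, real_inner_self_eq_norm_sq, inner_smul_left] at h1
  have h3 := real_inner_le_norm ξ (y - x')
  simp only [conj_trivial] at h1
  rw [norm_sub_rev]
  by_contra hlt
  push Not at hlt
  have h4 : 0 ≤ η * ‖ξ‖ := mul_nonneg hη (norm_nonneg _)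
  have h5 := mul_le_mul_of_nonneg_left h3 hη
  nlinarith

end Projection

/-- Separate (x, h x) from the open convex strict epigraph. The subgradient bounds are needed at
means of iterates, where the algorithm supplies no subgradient. -/
theorem exists_mem_subdiff {E : Type*} [NormedAddCommGroup E] [InnerProductSpace ℝ E]
    [FiniteDimensional ℝ E] {h : E → ℝ} (hh : ConvexOn ℝ Set.univ h) (x : E) :
    ∃ ξ, ξ ∈ subdiff h x := by
  have hcont : Continuous h := hh.locallyLipschitz.continuous
  have hconv := hh.convex_strict_epigraph
  simp only [Set.mem_univ, true_and] at hconv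
  have hopen : IsOpen {p : E × ℝ | h p.1 < p.2} :=
    isOpen_lt (hcont.comp continuous_fst) continuous_snd
  obtain ⟨f, hf⟩ := geometric_hahn_banach_open_point hconv hopen
    (show (x, h x) ∉ {p : E × ℝ | h p.1 < p.2} by simp)
  set g : E →L[ℝ] ℝ := f.comp (ContinuousLinearMap.inl ℝ E ℝ) with hg
  set c : ℝ := f (0, 1) with hc
  have hfe : ∀ y t, f (y, t) = g y + t * c := fun y t => by
    have : (y, t) = (y, (0 : ℝ)) + t • ((0 : E), (1 : ℝ)) := by simp
    rw [this, map_add, map_smul]; rfl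
  -- The hyperplane is not vertical: raising the point (x, h x) enters the strict epigraph.
  have hc0 : c < 0 := by
    have := hf (x, h x + 1) (by simp)
    rw [hfe, hfe] at this
    linarith
  have hle : ∀ y, g (y - x) ≤ -c * (h y - h x) := fun y => by
    refine le_of_forall_pos_lt_add fun ε hε => ?_
    have := hf (y, h y + ε / -c) (by simpa using div_pos hε (neg_pos.2 hc0))
    rw [hfe, hfe] at this
    have h1 : ε / -c * c = -ε := by
      have := hc0.ne
      field_simp
    rw [map_sub]
    nlinarith
  refine ⟨(-c)⁻¹ • (InnerProductSpace.toDual ℝ E).symm g, fun y => ?_⟩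
  rw [inner_smul_left, InnerProductSpace.toDual_symm_apply]
  have h2 := mul_le_mul_of_nonneg_left (hle y) (inv_nonneg.2 (neg_pos.2 hc0).le)
  rw [← mul_assoc, inv_mul_cancel₀ (neg_pos.2 hc0).ne', one_mul] at h2
  simpa using h2

section Doubling

/-- The constant of the doubling trick. -/
def doublingConst : ℝ := Real.sqrt 2 / (Real.sqrt 2 - 1)

theorem one_lt_sqrt_two : 1 < Real.sqrt 2 := by
  rw [Real.lt_sqrt zero_le_one]; norm_num

theorem doublingConst_pos : 0 < doublingConst :=
  div_pos (by linarith [one_lt_sqrt_two]) (by linarith [one_lt_sqrt_two])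

theorem sqrt_two_pow (k : ℕ) : Real.sqrt (2 ^ k) = Real.sqrt 2 ^ k := by
  have h : (2 : ℝ) ^ k = (Real.sqrt 2 ^ k) ^ 2 := by
    rw [← pow_mul, mul_comm k 2, pow_mul, Real.sq_sqrt (by norm_num)]
  rw [h, Real.sqrt_sq (by positivity)]

/-- A geometric sum of ratio √2, dominated by its last term, which is at most √T. Partial epochs (M
< 2 ^ k) are allowed because T may fall inside one. -/
theorem sum_le_of_epochs {a : ℕ → ℝ} {c : ℝ} (hc : 0 ≤ c)
    (h : ∀ k M : ℕ, M ≤ 2 ^ k → ∑ s ∈ Ico (2 ^ k) (2 ^ k + M), a s ≤ Real.sqrt (2 ^ k) * c)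
    {T : ℕ} (hT : 1 ≤ T) :
    ∑ s ∈ Ico 1 (T + 1), a s ≤ doublingConst * c * Real.sqrt T := by
  have h2 := one_lt_sqrt_two
  have hfull : ∀ K : ℕ, ∑ s ∈ Ico 1 (2 ^ K), a s ≤ c * ∑ k ∈ range K, Real.sqrt 2 ^ k := by
    intro K
    induction K with
    | zero => simp
    | succ K ih =>
      rw [← sum_Ico_consecutive a (Nat.one_le_two_pow (n := K))
        (pow_le_pow_right₀ one_le_two (Nat.le_succ K)), sum_range_succ, mul_add]
      refine add_le_add ih ?_
      have := h K (2 ^ K) le_rfl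
      rw [sqrt_two_pow] at this
      rw [pow_succ, mul_two, mul_comm c]
      exact this
  set K := Nat.log 2 T with hK
  have hlo : 2 ^ K ≤ T := Nat.pow_log_le_self 2 (by omega)
  have hhi : T < 2 ^ (K + 1) := Nat.lt_pow_succ_log_self one_lt_two T
  rw [pow_succ] at hhi
  rw [← sum_Ico_consecutive a (Nat.one_le_two_pow (n := K)) (by omega : 2 ^ K ≤ T + 1)]
  have hlast := h K (T + 1 - 2 ^ K) (by omega)
  rw [Nat.add_sub_cancel' (by omega), sqrt_two_pow] at hlast
  have hsum : ∑ s ∈ Ico 1 (2 ^ K), a s + ∑ s ∈ Ico (2 ^ K) (T + 1), a s ≤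
      c * ∑ k ∈ range (K + 1), Real.sqrt 2 ^ k := by
    rw [sum_range_succ, mul_add]
    exact add_le_add (hfull K) (by rwa [mul_comm c])
  refine hsum.trans ?_
  rw [geom_sum_eq h2.ne', doublingConst]
  have hsqrt : Real.sqrt 2 ^ K ≤ Real.sqrt T := by
    rw [← sqrt_two_pow]
    exact Real.sqrt_le_sqrt (by exact_mod_cast hlo)
  have hpos : 0 < Real.sqrt 2 - 1 := by linarith
  calc c * ((Real.sqrt 2 ^ (K + 1) - 1) / (Real.sqrt 2 - 1))
      ≤ c * (Real.sqrt 2 * Real.sqrt T / (Real.sqrt 2 - 1)) := by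
        refine mul_le_mul_of_nonneg_left (div_le_div_of_nonneg_right ?_ hpos.le) hc
        rw [pow_succ']
        nlinarith
    _ = _ := by ring

theorem DoublingTrick.eq_on_epoch {η : ℕ → ℝ} (hη : DoublingTrick η) {k M s : ℕ} (hM : M ≤ 2 ^ k)
    (hs : s ∈ Ico (2 ^ k) (2 ^ k + M)) : η s = (Real.sqrt (2 ^ k))⁻¹ := by
  rw [mem_Ico] at hs
  rw [hη k s hs.1 (by rw [pow_succ]; omega), one_div]

theorem DoublingTrick.pos {η : ℕ → ℝ} (hη : DoublingTrick η) {s : ℕ} (hs : 1 ≤ s) : 0 < η s := by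
  rw [hη (Nat.log 2 s) s (Nat.pow_log_le_self 2 (by omega))
    (Nat.lt_pow_succ_log_self one_lt_two s)]
  positivity

theorem DoublingTrick.sum_regret_le {η : ℕ → ℝ} (hη : DoublingTrick η) {a V : ℕ → ℝ} {R C : ℝ}
    (hR : 0 ≤ R) (hC : 0 ≤ C) (hV : ∀ s, 1 ≤ s → 0 ≤ V s) (hVR : ∀ s, 1 ≤ s → V s ≤ R)
    (hstep : ∀ s, 1 ≤ s → 2 * η s * a s ≤ V s - V (s + 1) + η s ^ 2 * C) {T : ℕ} (hT : 1 ≤ T) :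
    ∑ s ∈ Ico 1 (T + 1), a s ≤ doublingConst * (R / 2 + C / 2) * Real.sqrt T := by
  refine sum_le_of_epochs (by linarith) (fun k M hM => ?_) hT
  have h1 : 1 ≤ 2 ^ k := Nat.one_le_two_pow
  set S := Real.sqrt (2 ^ k) with hS
  have hSpos : 0 < S := Real.sqrt_pos.2 (by positivity)
  have hSS : S * S = 2 ^ k := Real.mul_self_sqrt (by positivity)
  have hpt : ∀ s ∈ Ico (2 ^ k) (2 ^ k + M), a s ≤ S / 2 * (V s - V (s + 1)) + C / (2 * S) := by
    intro s hs
    have h := hstep s (h1.trans (mem_Ico.1 hs).1)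
    rw [hη.eq_on_epoch hM hs] at h
    have h' := mul_le_mul_of_nonneg_left h (show 0 ≤ S / 2 by positivity)
    have e1 : S / 2 * (2 * S⁻¹ * a s) = a s := by field_simp
    have e2 : S / 2 * (V s - V (s + 1) + S⁻¹ ^ 2 * C) =
        S / 2 * (V s - V (s + 1)) + C / (2 * S) := by field_simp
    rwa [e1, e2] at h'
  refine (sum_le_sum hpt).trans ?_
  have htel : ∑ s ∈ Ico (2 ^ k) (2 ^ k + M), (V s - V (s + 1)) = V (2 ^ k) - V (2 ^ k + M) := by
    rw [sum_Ico_eq_sum_range, Nat.add_sub_cancel_left]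
    exact sum_range_sub' (fun i => V (2 ^ k + i)) M
  rw [sum_add_distrib, ← mul_sum, htel, sum_const, Nat.card_Ico, Nat.add_sub_cancel_left,
    nsmul_eq_mul]
  -- An epoch has at most S² steps, which balances the telescoped part against the squared
  -- gradients.
  have hMS : (M : ℝ) * (C / (2 * S)) ≤ S * (C / 2) := by
    have : (M : ℝ) ≤ S * S := by rw [hSS]; exact_mod_cast hM
    calc (M : ℝ) * (C / (2 * S)) ≤ S * S * (C / (2 * S)) :=
          mul_le_mul_of_nonneg_right this (by positivity)
      _ = _ := by field_simp
  have hVb : V (2 ^ k) - V (2 ^ k + M) ≤ R := by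
    linarith [hVR _ h1, hV (2 ^ k + M) (by omega)]
  have := mul_le_mul_of_nonneg_left hVb (show 0 ≤ S / 2 by positivity)
  linarith

end Doubling

section Consensus

variable {N d : ℕ}

/-- The hypotheses on the sequence of digraphs that enter the regret bounds. -/
structure MixingNetwork (G : ℕ → WeightedDigraph N) (σ e Λ : ℝ) (B : ℕ) : Prop where
  card_pos : 1 ≤ N
  e_pos : 0 < e
  e_le : e ≤ 1
  window_pos : 1 ≤ B
  σ_nonneg : 0 ≤ σ
  averaging : ∀ t, 1 ≤ t → IsAveraging e ((G t).averagingMatrix σ)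
  connected : ∀ k, 1 ≤ k → WindowConnected (fun t => (G t).averagingMatrix σ) (k * B) B
  singular_le : ∀ t, 1 ≤ t → maxSingularValue (G t).laplacian ≤ Λ

theorem MixingNetwork.Λ_nonneg {G : ℕ → WeightedDigraph N} {σ e Λ : ℝ} {B : ℕ}
    (h : MixingNetwork G σ e Λ B) : 0 ≤ Λ :=
  (maxSingularValue_nonneg _).trans (h.singular_le 1 le_rfl)

theorem MixingNetwork.Cu_nonneg {G : ℕ → WeightedDigraph N} {σ e Λ : ℝ} {B : ℕ}
    (h : MixingNetwork G σ e Λ B) : 0 ≤ Cu N B e := by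
  have h1 := stepFactor_lt_one h.window_pos h.card_pos h.e_pos h.e_le
  rw [stepFactor, windowFactor] at h1
  exact div_nonneg (by norm_num) (by linarith)

/-- A projected consensus-plus-gradient recursion with gradients `ξ` bounded by `H`. -/
structure ConsensusSeq (S : Set (EuclideanSpace ℝ (Fin d))) (G : ℕ → WeightedDigraph N) (σ : ℝ)
    (η : ℕ → ℝ) (x ξ : ℕ → Fin N → EuclideanSpace ℝ (Fin d)) (H : ℝ) : Prop where
  mem : ∀ t, 1 ≤ t → ∀ i, x t i ∈ S
  step : ∀ t, 1 ≤ t → ∀ i, IsOrthProj S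
    (x t i + σ • (∑ j, (G t).weight i j • (x t j - x t i)) - η t • ξ t i) (x (t + 1) i)
  bound : ∀ t, 1 ≤ t → famNorm (ξ t) ≤ H

variable {S : Set (EuclideanSpace ℝ (Fin d))} {G : ℕ → WeightedDigraph N} {σ e Λ : ℝ} {B : ℕ}
  {η : ℕ → ℝ} {x ξ : ℕ → Fin N → EuclideanSpace ℝ (Fin d)} {H Q R : ℝ}

theorem ConsensusSeq.bound_nonneg (h : ConsensusSeq S G σ η x ξ H) : 0 ≤ H :=
  (famNorm_nonneg _).trans (h.bound 1 le_rfl)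

theorem ConsensusSeq.mix_mem (h : ConsensusSeq S G σ η x ξ H) (hG : MixingNetwork G σ e Λ B)
    (hS : Convex ℝ S) {t : ℕ} (ht : 1 ≤ t) (i : Fin N) :
    mix ((G t).averagingMatrix σ) (x t) i ∈ S :=
  hS.sum_mem (fun j _ => (hG.averaging t ht).mem.1 i j)
    (sum_row_of_mem_doublyStochastic (hG.averaging t ht).mem i) fun j _ => h.mem t ht j

theorem ConsensusSeq.famNorm_disturbance_le (h : ConsensusSeq S G σ η x ξ H)
    (hG : MixingNetwork G σ e Λ B) (hS : Convex ℝ S) (hη : DoublingTrick η) {t : ℕ} (ht : 1 ≤ t) :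
    famNorm (fun i => x (t + 1) i - mix ((G t).averagingMatrix σ) (x t) i) ≤ η t * H := by
  have hη0 := (hη.pos ht).le
  refine le_trans ?_ (mul_le_mul_of_nonneg_left (h.bound t ht) hη0)
  rw [← famNorm_smul_le hη0]
  refine Real.sqrt_le_sqrt (sum_le_sum fun i _ => pow_le_pow_left₀ (norm_nonneg _) ?_ 2)
  have hs := h.step t ht i
  rw [← WeightedDigraph.mix_averagingMatrix] at hs
  rw [norm_smul, Real.norm_of_nonneg hη0]
  exact hs.norm_sub_le hS hη0 (h.mix_mem hG hS ht i)

/-- Each epoch restarts the perturbed contraction from a family of disagreement at most Q, with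
disturbances at most H / √(2^k). -/
theorem ConsensusSeq.sum_disagreement_le (h : ConsensusSeq S G σ η x ξ H)
    (hG : MixingNetwork G σ e Λ B) (hS : Convex ℝ S) (hη : DoublingTrick η)
    (hQ : ∀ t, 1 ≤ t → disagreement (x t) ≤ Q) {T : ℕ} (hT : 1 ≤ T) :
    ∑ s ∈ Ico 1 (T + 1), disagreement (x s) ≤
      doublingConst * (Cu N B e / 2 * (Q + H)) * Real.sqrt T := by
  have hC : 0 ≤ Cu N B e / 2 := by linarith [hG.Cu_nonneg]
  have hH := h.bound_nonneg
  have hQ0 : 0 ≤ Q := (disagreement_nonneg _).trans (hQ 1 le_rfl)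
  refine sum_le_of_epochs (mul_nonneg hC (by linarith)) (fun k M hM => ?_) hT
  have h1 : 1 ≤ 2 ^ k := Nat.one_le_two_pow
  set S' := Real.sqrt (2 ^ k) with hS'
  have hS1 : 1 ≤ S' := by
    rw [hS', Real.one_le_sqrt]; exact_mod_cast h1
  have hSS : S' * S' = 2 ^ k := Real.mul_self_sqrt (by positivity)
  refine (sum_disagreement_perturbed hG.card_pos hG.e_pos hG.e_le hG.averaging hG.window_pos
    hG.connected x (U := S'⁻¹ * H) (by positivity) M h1 fun t ht1 ht2 => ?_).trans ?_
  · have := h.famNorm_disturbance_le hG hS hη (h1.trans ht1)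
    rwa [hη.eq_on_epoch hM (mem_Ico.2 ⟨ht1, ht2⟩)] at this
  · have hMS : (M : ℝ) * (S'⁻¹ * H) ≤ S' * H := by
      have : (M : ℝ) ≤ S' * S' := by rw [hSS]; exact_mod_cast hM
      calc (M : ℝ) * (S'⁻¹ * H) ≤ S' * S' * (S'⁻¹ * H) :=
            mul_le_mul_of_nonneg_right this (by positivity)
        _ = _ := by field_simp
    have hd := hQ _ h1
    -- The initial disagreement is paid once per epoch; S' ≥ 1 brings it to the common scale.
    have hQS : Q ≤ S' * Q := le_mul_of_one_le_left hQ0 hS1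
    calc Cu N B e / 2 * (disagreement (x (2 ^ k)) + M * (S'⁻¹ * H))
        ≤ Cu N B e / 2 * (S' * Q + S' * H) := mul_le_mul_of_nonneg_left (by linarith) hC
      _ = _ := by ring

/-- The projected gradient step starts at the mixed family y, so regret telescopes at y. Passing
back to x costs σ times the Laplacian of x, which the disagreement controls. -/
theorem ConsensusSeq.sum_regret_le (h : ConsensusSeq S G σ η x ξ H)
    (hG : MixingNetwork G σ e Λ B) (hS : Convex ℝ S) (hη : DoublingTrick η)
    (hQ : ∀ t, 1 ≤ t → disagreement (x t) ≤ Q) {p : EuclideanSpace ℝ (Fin d)} (hp : p ∈ S)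
    (hR : ∀ t, 1 ≤ t → ∑ i, ‖x t i - p‖ ^ 2 ≤ R) {T : ℕ} (hT : 1 ≤ T) :
    ∑ s ∈ Ico 1 (T + 1), ∑ i, inner ℝ (ξ s i) (x s i - p) ≤
      doublingConst * (R / 2 + H ^ 2 / 2 + H * (σ * Λ) * (Cu N B e / 2 * (Q + H))) *
        Real.sqrt T := by
  have hH := h.bound_nonneg
  have hR0 : 0 ≤ R := (sum_nonneg fun _ _ => sq_nonneg _).trans (hR 1 le_rfl)
  have hσΛ : 0 ≤ σ * Λ := mul_nonneg hG.σ_nonneg hG.Λ_nonneg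
  set y : ℕ → Fin N → EuclideanSpace ℝ (Fin d) :=
    fun t => mix ((G t).averagingMatrix σ) (x t) with hy
  have hmain : ∑ s ∈ Ico 1 (T + 1), ∑ i, inner ℝ (ξ s i) (y s i - p) ≤
      doublingConst * (R / 2 + H ^ 2 / 2) * Real.sqrt T := by
    refine hη.sum_regret_le (V := fun t => ∑ i, ‖x t i - p‖ ^ 2) hR0 (sq_nonneg H)
      (fun s _ => sum_nonneg fun _ _ => sq_nonneg _) hR (fun s hs => ?_) hT
    have hpt : ∀ i, 2 * η s * inner ℝ (ξ s i) (y s i - p) ≤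
        ‖y s i - p‖ ^ 2 - ‖x (s + 1) i - p‖ ^ 2 + η s ^ 2 * ‖ξ s i‖ ^ 2 := fun i => by
      have hst := h.step s hs i
      rw [← WeightedDigraph.mix_averagingMatrix] at hst
      exact hst.two_mul_inner_le hS hp
    have hsum := sum_le_sum fun i (_ : i ∈ univ) => hpt i
    rw [← mul_sum, sum_add_distrib, sum_sub_distrib, ← mul_sum,
      ← famNorm_sq (ξ s)] at hsum
    have hmix := sum_norm_mix_sub_sq_le (hG.averaging s hs).mem (x s) p
    have hξ := pow_le_pow_left₀ (famNorm_nonneg _) (h.bound s hs) 2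
    have hξ' := mul_le_mul_of_nonneg_left hξ (sq_nonneg (η s))
    simp only [hy] at hsum ⊢
    linarith
  have hpt : ∀ s ∈ Ico 1 (T + 1), ∑ i, inner ℝ (ξ s i) (x s i - p) ≤
      ∑ i, inner ℝ (ξ s i) (y s i - p) + H * (σ * Λ) * disagreement (x s) := by
    intro s hs
    have hs1 := (mem_Ico.1 hs).1
    have hyx : ∀ i, x s i - p = (y s i - p) + σ • mix (G s).laplacian (x s) i := fun i => by
      simp only [hy]
      rw [WeightedDigraph.mix_averagingMatrix, WeightedDigraph.mix_laplacian, smul_neg]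
      abel
    simp only [hyx, inner_add_right, sum_add_distrib]
    gcongr
    refine (sum_inner_le_famNorm _ _).trans ?_
    rw [famNorm_smul_le hG.σ_nonneg]
    have h1 := WeightedDigraph.famNorm_mix_laplacian_le (G s) (x s)
    have h2 := mul_le_mul_of_nonneg_right (hG.singular_le s hs1) (disagreement_nonneg (x s))
    calc famNorm (ξ s) * (σ * famNorm (mix (G s).laplacian (x s)))
        ≤ H * (σ * (Λ * disagreement (x s))) := by
          refine mul_le_mul (h.bound s hs1)
            (mul_le_mul_of_nonneg_left (h1.trans h2) hG.σ_nonneg)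
            (mul_nonneg hG.σ_nonneg (famNorm_nonneg _)) hH
      _ = _ := by ring
  refine (sum_le_sum hpt).trans ?_
  rw [sum_add_distrib, ← mul_sum]
  have hdis := mul_le_mul_of_nonneg_left (h.sum_disagreement_le hG hS hη hQ hT)
    (mul_nonneg hH hσΛ)
  linarith

end Consensus

end Regret

end CSPSG

namespace CSPSG

/-! ### Convex-concave structure: averages, subgradient bounds and agreement of copies. -/

noncomputable section Saddle

open Finset

section Averages

variable {E : Type*}

theorem Convex.mean_mem {N : ℕ} [AddCommGroup E] [Module ℝ E] {S : Set E} (hS : Convex ℝ S)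
    (hN : 1 ≤ N) {x : Fin N → E} (hx : ∀ i, x i ∈ S) : mean x ∈ S := by
  have hN' : (N : ℝ) ≠ 0 := by positivity
  rw [mean, smul_sum]
  exact hS.sum_mem (fun _ _ => by positivity) (by simp [hN']) fun i _ => hx i

theorem runAvg_succ [AddCommGroup E] [Module ℝ E] (x : ℕ → E) (T : ℕ) :
    runAvg x (T + 1) = ∑ s ∈ Ico 1 (T + 1), (T : ℝ)⁻¹ • x s := by
  rw [runAvg, smul_sum]
  push_cast
  rw [add_sub_cancel_right]

theorem runAvg_weights {T : ℕ} (hT : 1 ≤ T) : ∑ _s ∈ Ico 1 (T + 1), (T : ℝ)⁻¹ = 1 := by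
  have hT' : (T : ℝ) ≠ 0 := by positivity
  simp [hT']

theorem Convex.runAvg_mem [AddCommGroup E] [Module ℝ E] {S : Set E} (hS : Convex ℝ S) {T : ℕ}
    (hT : 1 ≤ T) {x : ℕ → E} (hx : ∀ s, 1 ≤ s → x s ∈ S) : runAvg x (T + 1) ∈ S := by
  rw [runAvg_succ]
  exact hS.sum_mem (fun _ _ => by positivity) (runAvg_weights hT) fun s hs =>
    hx s (mem_Ico.1 hs).1

theorem disagreement_runAvg_le {N : ℕ} [NormedAddCommGroup E] [InnerProductSpace ℝ E] {T : ℕ}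
    (hT : 1 ≤ T) (x : ℕ → Fin N → E) :
    T * disagreement (runAvg x (T + 1)) ≤ ∑ s ∈ Ico 1 (T + 1), disagreement (x s) := by
  have hsum : ∀ A : Finset ℕ,
      disagreement (fun i => ∑ s ∈ A, x s i) ≤ ∑ s ∈ A, disagreement (x s) := by
    classical
    intro A
    induction A using Finset.induction_on with
    | empty => simp [disagreement, famNorm, mean]
    | insert a A ha ih =>
      rw [sum_insert ha]
      refine le_trans (le_of_eq ?_) ((disagreement_add_le _ _).trans (add_le_add_right ih _))
      congr 1
      ext1 i
      rw [sum_insert ha]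
  have hT' : (T : ℝ) ≠ 0 := by positivity
  rw [← disagreement_smul (Nat.cast_nonneg T)]
  refine le_trans (le_of_eq ?_) (hsum _)
  congr 1
  ext1 i
  rw [runAvg_succ, ← smul_sum, Pi.smul_apply, smul_smul, mul_inv_cancel₀ hT', one_smul,
    Finset.sum_apply]

end Averages

section MultiplierSet

variable {m : ℕ} {r : ℝ}

theorem convex_orthant : Convex ℝ (orthant m) := by
  intro x hx y hy a b ha hb _ l
  have h1 := mul_nonneg ha (hx l)
  have h2 := mul_nonneg hb (hy l)
  simpa using add_nonneg h1 h2

theorem convex_multiplierSet : Convex ℝ (Problem.multiplierSet m r) :=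
  convex_orthant.inter (convex_closedBall 0 r)

theorem norm_le_of_mem_multiplierSet {z : EuclideanSpace ℝ (Fin m)} (hz : z ∈ Problem.multiplierSet m r) :
    ‖z‖ ≤ r := mem_closedBall_zero_iff.1 hz.2

/-- The multiplier is nonnegative, so its coordinate sum is its 1-norm, at most √m times its
Euclidean norm. -/
theorem norm_add_sum_smul_le {E : Type*} [NormedAddCommGroup E] [NormedSpace ℝ E]
    {z : EuclideanSpace ℝ (Fin m)} (hz : z ∈ Problem.multiplierSet m r) {a : E} {b : Fin m → E}
    {Hf Hg : ℝ} (ha : ‖a‖ ≤ Hf) (hb : ∀ l, ‖b l‖ ≤ Hg) :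
    ‖a + ∑ l, z l • b l‖ ≤ Hf + r * Real.sqrt m * Hg := by
  refine (norm_add_le _ _).trans (add_le_add ha ?_)
  -- Without constraints `Hg` may be negative, but √m = 0 removes its term.
  rcases Nat.eq_zero_or_pos m with rfl | hm
  · simp
  have hHg : 0 ≤ Hg := (norm_nonneg _).trans (hb ⟨0, hm⟩)
  have hsum : ∑ l, z l ≤ Real.sqrt m * ‖z‖ := by
    have h1 : (∑ l, z l) ^ 2 ≤ m * ‖z‖ ^ 2 := by
      rw [EuclideanSpace.real_norm_sq_eq]
      simpa using sq_sum_le_card_mul_sum_sq (s := (univ : Finset (Fin m))) (f := fun l => z l)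
    have h2 := Real.le_sqrt_of_sq_le h1
    rwa [Real.sqrt_mul (Nat.cast_nonneg m), Real.sqrt_sq (norm_nonneg z)] at h2
  calc ‖∑ l, z l • b l‖ ≤ ∑ l, z l * Hg := by
        refine (norm_sum_le _ _).trans (sum_le_sum fun l _ => ?_)
        rw [norm_smul, Real.norm_of_nonneg (hz.1 l)]
        exact mul_le_mul_of_nonneg_left (hb l) (hz.1 l)
    _ = (∑ l, z l) * Hg := (sum_mul _ _ _).symm
    _ ≤ r * Real.sqrt m * Hg := by
        refine mul_le_mul_of_nonneg_right (hsum.trans ?_) hHg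
        rw [mul_comm]
        exact mul_le_mul_of_nonneg_right (norm_le_of_mem_multiplierSet hz) (Real.sqrt_nonneg _)

end MultiplierSet

namespace Problem

variable {N m d : ℕ} (P : Problem N m d)

/-- The term of agent `i` in `φ`. -/
def agentLagrangian (i : Fin N) (z : EuclideanSpace ℝ (Fin m)) (x : EuclideanSpace ℝ (Fin (P.n i)))
    (y : EuclideanSpace ℝ (Fin d)) : ℝ :=
  P.f i x y + inner ℝ z (P.g i x y)

theorem phi_eq (w : P.Locals) (D : Fin N → EuclideanSpace ℝ (Fin d))
    (z : Fin N → EuclideanSpace ℝ (Fin m)) :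
    P.phi w D z = ∑ i, P.agentLagrangian i (z i) (w i) (D i) := rfl

theorem agentLagrangian_eq (i : Fin N) (z : EuclideanSpace ℝ (Fin m))
    (x : EuclideanSpace ℝ (Fin (P.n i))) (y : EuclideanSpace ℝ (Fin d)) :
    P.agentLagrangian i z x y = P.f i x y + ∑ l, z l * P.g i x y l := by
  simp [agentLagrangian, PiLp.inner_apply, mul_comm]

theorem convexOn_agentLagrangian (i : Fin N) {z : EuclideanSpace ℝ (Fin m)} (hz : z ∈ orthant m) :
    ConvexOn ℝ Set.univ (fun p : EuclideanSpace ℝ (Fin (P.n i)) × EuclideanSpace ℝ (Fin d) =>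
      P.agentLagrangian i z p.1 p.2) := by
  refine ⟨convex_univ, fun p _ q _ a b ha hb hab => ?_⟩
  simp only [agentLagrangian_eq]
  have hf := (P.convex_f i).2 (Set.mem_univ p) (Set.mem_univ q) ha hb hab
  have hg : ∑ l, z l * P.g i (a • p + b • q).1 (a • p + b • q).2 l ≤
      a * ∑ l, z l * P.g i p.1 p.2 l + b * ∑ l, z l * P.g i q.1 q.2 l := by
    rw [mul_sum, mul_sum, ← sum_add_distrib]
    refine sum_le_sum fun l _ => ?_
    have := mul_le_mul_of_nonneg_left
      ((P.convex_g i l).2 (Set.mem_univ p) (Set.mem_univ q) ha hb hab) (hz l)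
    simp only [smul_eq_mul] at this
    linarith
  simp only [smul_eq_mul] at hf ⊢
  linarith

theorem agentLagrangian_sub (i : Fin N) (z z' : EuclideanSpace ℝ (Fin m))
    (x : EuclideanSpace ℝ (Fin (P.n i))) (y : EuclideanSpace ℝ (Fin d)) :
    P.agentLagrangian i z x y - P.agentLagrangian i z' x y = inner ℝ (z - z') (P.g i x y) := by
  simp only [agentLagrangian, inner_sub_left]
  ring

theorem phi_sub_phi_multiplier (w : P.Locals) (D : Fin N → EuclideanSpace ℝ (Fin d))
    (z z' : Fin N → EuclideanSpace ℝ (Fin m)) :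
    P.phi w D z - P.phi w D z' = ∑ i, inner ℝ (z i - z' i) (P.g i (w i) (D i)) := by
  rw [phi_eq, phi_eq, ← sum_sub_distrib]
  exact sum_congr rfl fun i _ => P.agentLagrangian_sub i _ _ _ _

theorem add_sum_smul_mem_jointSubdiff {i : Fin N} {z : EuclideanSpace ℝ (Fin m)}
    (hz : z ∈ orthant m) {x : EuclideanSpace ℝ (Fin (P.n i))} {y : EuclideanSpace ℝ (Fin d)}
    {a : EuclideanSpace ℝ (Fin (P.n i)) × EuclideanSpace ℝ (Fin d)}
    {b : Fin m → EuclideanSpace ℝ (Fin (P.n i)) × EuclideanSpace ℝ (Fin d)}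
    (ha : a ∈ jointSubdiff (P.f i) x y)
    (hb : ∀ l, b l ∈ jointSubdiff (fun x y => P.g i x y l) x y) :
    (a.1 + ∑ l, z l • (b l).1, a.2 + ∑ l, z l • (b l).2) ∈
      jointSubdiff (P.agentLagrangian i z) x y := by
  intro x' y'
  simp only [agentLagrangian_eq, inner_add_left, sum_inner, inner_smul_left, conj_trivial]
  have h1 := ha x' y'
  have h2 : ∑ l, z l * inner ℝ (b l).1 (x' - x) + ∑ l, z l * inner ℝ (b l).2 (y' - y) ≤
      ∑ l, z l * P.g i x' y' l - ∑ l, z l * P.g i x y l := by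
    rw [← sum_add_distrib, ← sum_sub_distrib]
    refine sum_le_sum fun l _ => ?_
    have := mul_le_mul_of_nonneg_left (hb l x' y') (hz l)
    linarith
  linarith

theorem phi_runAvg_primal_le {T : ℕ} (hT : 1 ≤ T) (w : ℕ → P.Locals)
    (D : ℕ → Fin N → EuclideanSpace ℝ (Fin d)) {z : Fin N → EuclideanSpace ℝ (Fin m)}
    (hz : ∀ i, z i ∈ orthant m) :
    T * P.phi (runAvg w (T + 1)) (runAvg D (T + 1)) z ≤
      ∑ s ∈ Ico 1 (T + 1), P.phi (w s) (D s) z := by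
  have hT' : (T : ℝ) ≠ 0 := by positivity
  simp only [phi_eq]
  rw [sum_comm, mul_sum]
  refine sum_le_sum fun i _ => ?_
  have h := (P.convexOn_agentLagrangian i (hz i)).map_sum_le (t := Ico 1 (T + 1))
    (w := fun _ => (T : ℝ)⁻¹) (p := fun s => (w s i, D s i)) (fun _ _ => by positivity)
    (runAvg_weights hT) fun _ _ => Set.mem_univ _
  simp only [Prod.fst_sum, Prod.snd_sum, Prod.smul_mk, smul_eq_mul, ← mul_sum] at h
  have h' := mul_le_mul_of_nonneg_left h (Nat.cast_nonneg (α := ℝ) T)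
  rw [← mul_assoc, mul_inv_cancel₀ hT', one_mul] at h'
  simpa only [runAvg_succ, Finset.sum_apply, Pi.smul_apply] using h'

theorem phi_runAvg_dual {T : ℕ} (hT : 1 ≤ T) (w : P.Locals)
    (D : Fin N → EuclideanSpace ℝ (Fin d)) (z : ℕ → Fin N → EuclideanSpace ℝ (Fin m)) :
    T * P.phi w D (runAvg z (T + 1)) = ∑ s ∈ Ico 1 (T + 1), P.phi w D (z s) := by
  have hT' : (T : ℝ) ≠ 0 := by positivity
  simp only [phi_eq]
  rw [sum_comm, mul_sum]
  refine sum_congr rfl fun i _ => ?_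
  simp only [agentLagrangian, runAvg_succ, Finset.sum_apply, Pi.smul_apply, sum_add_distrib,
    sum_inner, inner_smul_left, conj_trivial, ← mul_sum, mul_add]
  rw [← mul_assoc, mul_inv_cancel₀ hT', one_mul]
  simp

/-- The bounds on the partial subdifferentials over the primal sets. -/
structure SubdiffBounds (Hfw HfD Hgw HgD : ℝ) : Prop where
  fw : ∀ i, ∀ x ∈ P.W i, ∀ y ∈ P.Dset,
    subdiff (fun x' => P.f i x' y) x ⊆ Metric.closedBall 0 Hfw
  fD : ∀ i, ∀ x ∈ P.W i, ∀ y ∈ P.Dset,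
    subdiff (fun y' => P.f i x y') y ⊆ Metric.closedBall 0 HfD
  gw : ∀ i l, ∀ x ∈ P.W i, ∀ y ∈ P.Dset,
    subdiff (fun x' => P.g i x' y l) x ⊆ Metric.closedBall 0 Hgw
  gD : ∀ i l, ∀ x ∈ P.W i, ∀ y ∈ P.Dset,
    subdiff (fun y' => P.g i x y' l) y ⊆ Metric.closedBall 0 HgD

end Problem

theorem fst_mem_subdiff {E F : Type*} [NormedAddCommGroup E] [InnerProductSpace ℝ E]
    [NormedAddCommGroup F] [InnerProductSpace ℝ F] {h : E → F → ℝ} {x : E} {y : F} {ξ : E × F}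
    (hξ : ξ ∈ jointSubdiff h x y) : ξ.1 ∈ subdiff (fun x' => h x' y) x := fun x' => by
  simpa using hξ x' y

theorem snd_mem_subdiff {E F : Type*} [NormedAddCommGroup E] [InnerProductSpace ℝ E]
    [NormedAddCommGroup F] [InnerProductSpace ℝ F] {h : E → F → ℝ} {x : E} {y : F} {ξ : E × F}
    (hξ : ξ ∈ jointSubdiff h x y) : ξ.2 ∈ subdiff (fun y' => h x y') y := fun y' => by
  simpa using hξ x y'

theorem convexOn_partial {E F : Type*} [AddCommGroup E] [Module ℝ E] [AddCommGroup F] [Module ℝ F]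
    {h : E → F → ℝ} (hh : ConvexOn ℝ Set.univ fun p : E × F => h p.1 p.2) (x : E) :
    ConvexOn ℝ Set.univ (h x) := by
  refine ⟨convex_univ, fun y _ y' _ a b ha hb hab => ?_⟩
  have := hh.2 (Set.mem_univ (x, y)) (Set.mem_univ (x, y')) ha hb hab
  simpa [← add_smul, hab] using this

namespace Problem

variable {N m d : ℕ} {P : Problem N m d} {Hfw HfD Hgw HgD r : ℝ}

/-- Combine subgradients in the global variable at y, weighted by the nonnegative multiplier; only y
has to lie where the bounds hold. -/
theorem SubdiffBounds.agentLagrangian_ge (hb : P.SubdiffBounds Hfw HfD Hgw HgD) {i : Fin N}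
    {z : EuclideanSpace ℝ (Fin m)} (hz : z ∈ multiplierSet m r)
    {x : EuclideanSpace ℝ (Fin (P.n i))} (hx : x ∈ P.W i) {y : EuclideanSpace ℝ (Fin d)}
    (hy : y ∈ P.Dset) (y' : EuclideanSpace ℝ (Fin d)) :
    P.agentLagrangian i z x y - (HfD + r * Real.sqrt m * HgD) * ‖y' - y‖ ≤
      P.agentLagrangian i z x y' := by
  obtain ⟨a, ha⟩ := exists_mem_subdiff (convexOn_partial (P.convex_f i) x) y
  have hex := fun l =>
    exists_mem_subdiff (convexOn_partial (h := fun x y => P.g i x y l) (P.convex_g i l) x) y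
  choose b hbm using hex
  have hna := mem_closedBall_zero_iff.1 (hb.fD i x hx y hy ha)
  have hnb := fun l => mem_closedBall_zero_iff.1 (hb.gD i l x hx y hy (hbm l))
  have hn := norm_add_sum_smul_le hz hna hnb
  have hin : inner ℝ (a + ∑ l, z l • b l) (y' - y) ≤
      P.agentLagrangian i z x y' - P.agentLagrangian i z x y := by
    simp only [agentLagrangian_eq, inner_add_left, sum_inner, inner_smul_left, conj_trivial]
    have h1 := ha y'
    have h2 : ∑ l, z l * inner ℝ (b l) (y' - y) ≤
        ∑ l, z l * P.g i x y' l - ∑ l, z l * P.g i x y l := by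
      rw [← sum_sub_distrib]
      refine sum_le_sum fun l _ => ?_
      have := mul_le_mul_of_nonneg_left (hbm l y') (hz.1 l)
      linarith
    linarith
  have h3 := neg_le_of_abs_le (abs_real_inner_le_norm (a + ∑ l, z l • b l) (y' - y))
  have h4 := mul_le_mul_of_nonneg_right hn (norm_nonneg (y' - y))
  linarith

theorem sum_norm_le_sqrt_mul_famNorm {E : Type*} [NormedAddCommGroup E] (x : Fin N → E) :
    ∑ i, ‖x i‖ ≤ Real.sqrt N * famNorm x := by
  rw [famNorm, ← Real.sqrt_mul (Nat.cast_nonneg N)]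
  refine Real.le_sqrt_of_sq_le ?_
  simpa using sq_sum_le_card_mul_sum_sq (s := (univ : Finset (Fin N))) (f := fun i => ‖x i‖)

theorem Hprimal_eq {h g : ℝ} (h0 : 0 ≤ h + r * Real.sqrt m * g) :
    Hprimal N m r h g = Real.sqrt N * (h + r * Real.sqrt m * g) := by
  rw [Hprimal, Real.sqrt_mul (Nat.cast_nonneg N), Real.sqrt_sq h0]

/-- Take the base point at the mean, which stays in the convex set; Cauchy–Schwarz over the agents
turns the deviations into √N times the disagreement. -/
theorem SubdiffBounds.phi_mean_sub_le (hb : P.SubdiffBounds Hfw HfD Hgw HgD) (hN : 1 ≤ N)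
    {z : Fin N → EuclideanSpace ℝ (Fin m)} (hz : ∀ i, z i ∈ multiplierSet m r) {w : P.Locals}
    (hw : ∀ i, w i ∈ P.W i) {D : Fin N → EuclideanSpace ℝ (Fin d)} (hD : ∀ i, D i ∈ P.Dset) :
    P.phi w (fun _ => mean D) z - Hprimal N m r HfD HgD * disagreement D ≤ P.phi w D z := by
  have hmean := Convex.mean_mem P.convex_Dset hN hD
  set h := HfD + r * Real.sqrt m * HgD with hh
  have hpt : ∀ i, P.agentLagrangian i (z i) (w i) (mean D) - h * ‖D i - mean D‖ ≤
      P.agentLagrangian i (z i) (w i) (D i) := fun i =>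
    hb.agentLagrangian_ge (hz i) (hw i) hmean (D i)
  have hsum := sum_le_sum fun i (_ : i ∈ univ) => hpt i
  rw [sum_sub_distrib, ← mul_sum] at hsum
  -- `Hprimal` sees only the square of this constant; its sign follows from bounding the norm of an
  -- actual subgradient combination.
  have h0 : 0 ≤ h := by
    have i : Fin N := ⟨0, hN⟩
    obtain ⟨a, ha⟩ := exists_mem_subdiff (convexOn_partial (P.convex_f i) (w i)) (D i)
    have hex := fun l => exists_mem_subdiff
      (convexOn_partial (h := fun x y => P.g i x y l) (P.convex_g i l) (w i)) (D i)
    choose b hbm using hex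
    exact (norm_nonneg _).trans (norm_add_sum_smul_le (hz i)
      (mem_closedBall_zero_iff.1 (hb.fD i _ (hw i) _ (hD i) ha))
      fun l => mem_closedBall_zero_iff.1 (hb.gD i l _ (hw i) _ (hD i) (hbm l)))
  have hcs := mul_le_mul_of_nonneg_left (sum_norm_le_sqrt_mul_famNorm fun i => D i - mean D) h0
  rw [Hprimal_eq h0, ← hh, phi_eq, phi_eq, disagreement]
  linarith

theorem continuous_g (P : Problem N m d) (i : Fin N) :
    Continuous fun p : EuclideanSpace ℝ (Fin (P.n i)) × EuclideanSpace ℝ (Fin d) =>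
      P.g i p.1 p.2 := by
  have h : Continuous fun p : EuclideanSpace ℝ (Fin (P.n i)) × EuclideanSpace ℝ (Fin d) =>
      fun l => P.g i p.1 p.2 l :=
    continuous_pi fun l => (P.convex_g i l).locallyLipschitz.continuous
  exact (PiLp.continuous_toLp 2 fun _ : Fin m => ℝ).comp h

theorem famNorm_g_le (hW : ∀ i, IsCompact (P.W i)) (hD : IsCompact P.Dset) {w : P.Locals}
    (hw : ∀ i, w i ∈ P.W i) {D : Fin N → EuclideanSpace ℝ (Fin d)} (hDm : ∀ i, D i ∈ P.Dset) :
    famNorm (fun i => P.g i (w i) (D i)) ≤ P.Hz := by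
  refine Real.sqrt_le_sqrt (sum_le_sum fun i _ => pow_le_pow_left₀ (norm_nonneg _) ?_ 2)
  exact le_csSup (((hW i).prod hD).image (P.continuous_g i).norm).bddAbove
    ⟨(w i, D i), ⟨hw i, hDm i⟩, rfl⟩

theorem Hz_nonneg (P : Problem N m d) : 0 ≤ P.Hz := Real.sqrt_nonneg _

theorem phi_sub_phi_mean_le (hW : ∀ i, IsCompact (P.W i)) (hD : IsCompact P.Dset) {w : P.Locals}
    (hw : ∀ i, w i ∈ P.W i) {D : Fin N → EuclideanSpace ℝ (Fin d)} (hDm : ∀ i, D i ∈ P.Dset)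
    (z : Fin N → EuclideanSpace ℝ (Fin m)) :
    P.phi w D z - P.phi w D (fun _ => mean z) ≤ P.Hz * disagreement z := by
  rw [phi_sub_phi_multiplier, mul_comm]
  exact (sum_inner_le_famNorm _ _).trans
    (mul_le_mul_of_nonneg_left (famNorm_g_le hW hD hw hDm) (famNorm_nonneg _))

/-- Weak duality at the saddle: q(z') ≤ L(w, D, z') ≤ L(w, D, z) ≤ q(z). -/
theorem IsSaddle.mem_optimalDualSet {w : P.Locals} {D : EuclideanSpace ℝ (Fin d)}
    {z : EuclideanSpace ℝ (Fin m)} (h : P.IsSaddle w D z) : z ∈ P.optimalDualSet := by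
  refine ⟨h.z_mem, fun z' hz' => ?_⟩
  calc P.dualFunction z' ≤ ((P.lagrangian w D z' : ℝ) : EReal) :=
        iInf₂_le_of_le w h.w_mem (iInf₂_le D h.D_mem)
    _ ≤ ((P.lagrangian w D z : ℝ) : EReal) := EReal.coe_le_coe_iff.2 (h.dual z' hz')
    _ ≤ P.dualFunction z := le_iInf₂ fun w' hw' => le_iInf₂ fun D' hD' =>
        EReal.coe_le_coe_iff.2 (h.primal w' D' hw' hD')

end Problem

end Saddle

end CSPSG

namespace CSPSG

/-! ### Regret of a trajectory and the saddle estimates. -/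

noncomputable section Main

open Finset

namespace Problem

variable {N m d : ℕ} {P : Problem N m d} {Hfw HfD Hgw HgD r σ : ℝ} {η : ℕ → ℝ}
  {G : ℕ → WeightedDigraph N} {w : ℕ → P.Locals} {D : ℕ → Fin N → EuclideanSpace ℝ (Fin d)}
  {z : ℕ → Fin N → EuclideanSpace ℝ (Fin m)}

theorem IsTrajectory.w_mem (h : P.IsTrajectory r σ η G w D z) {t : ℕ} (ht : 1 ≤ t) (i : Fin N) :
    w t i ∈ P.W i := by
  induction t, ht using Nat.le_induction with
  | base => exact h.init_w i
  | succ t ht _ =>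
    obtain ⟨a, b, -, -, hw, -, -⟩ := h.step t ht i
    exact hw.1

theorem IsTrajectory.D_mem (h : P.IsTrajectory r σ η G w D z) {t : ℕ} (ht : 1 ≤ t) (i : Fin N) :
    D t i ∈ P.Dset := by
  induction t, ht using Nat.le_induction with
  | base => exact h.init_D i
  | succ t ht _ =>
    obtain ⟨a, b, -, -, -, hD, -⟩ := h.step t ht i
    exact hD.1

theorem IsTrajectory.z_mem (h : P.IsTrajectory r σ η G w D z) {t : ℕ} (ht : 1 ≤ t) (i : Fin N) :
    z t i ∈ multiplierSet m r := by
  induction t, ht using Nat.le_induction with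
  | base => exact h.init_z i
  | succ t ht _ =>
    obtain ⟨a, b, -, -, -, -, hz⟩ := h.step t ht i
    exact hz.1

/-- The primal gradients used by a trajectory. -/
structure IsPrimalGradient (P : Problem N m d) (Hfw HfD Hgw HgD r σ : ℝ) (η : ℕ → ℝ)
    (G : ℕ → WeightedDigraph N) (w : ℕ → P.Locals) (D : ℕ → Fin N → EuclideanSpace ℝ (Fin d))
    (z : ℕ → Fin N → EuclideanSpace ℝ (Fin m)) (ξw : ℕ → P.Locals)
    (ξD : ℕ → Fin N → EuclideanSpace ℝ (Fin d)) : Prop where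
  mem : ∀ t, 1 ≤ t → ∀ i,
    (ξw t i, ξD t i) ∈ jointSubdiff (P.agentLagrangian i (z t i)) (w t i) (D t i)
  step_w : ∀ t, 1 ≤ t → ∀ i, IsOrthProj (P.W i) (w t i - η t • ξw t i) (w (t + 1) i)
  step_D : ∀ t, 1 ≤ t → ∀ i, IsOrthProj P.Dset
    (D t i + σ • (∑ j, (G t).weight i j • (D t j - D t i)) - η t • ξD t i) (D (t + 1) i)
  norm_w : ∀ t, 1 ≤ t → ∀ i, ‖ξw t i‖ ≤ Hfw + r * Real.sqrt m * Hgw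
  norm_D : ∀ t, 1 ≤ t → ∀ i, ‖ξD t i‖ ≤ HfD + r * Real.sqrt m * HgD

theorem IsTrajectory.exists_isPrimalGradient (h : P.IsTrajectory r σ η G w D z)
    (hb : P.SubdiffBounds Hfw HfD Hgw HgD) :
    ∃ ξw ξD, P.IsPrimalGradient Hfw HfD Hgw HgD r σ η G w D z ξw ξD := by
  have hex : ∀ t i, ∃ (u : EuclideanSpace ℝ (Fin (P.n i))) (v : EuclideanSpace ℝ (Fin d)),
      1 ≤ t → (u, v) ∈ jointSubdiff (P.agentLagrangian i (z t i)) (w t i) (D t i) ∧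
        IsOrthProj (P.W i) (w t i - η t • u) (w (t + 1) i) ∧
        IsOrthProj P.Dset (D t i + σ • (∑ j, (G t).weight i j • (D t j - D t i)) - η t • v)
          (D (t + 1) i) ∧
        ‖u‖ ≤ Hfw + r * Real.sqrt m * Hgw ∧ ‖v‖ ≤ HfD + r * Real.sqrt m * HgD := by
    intro t i
    by_cases ht : 1 ≤ t
    · obtain ⟨a, b, ha, hbm, hw, hD, -⟩ := h.step t ht i
      have hz := h.z_mem ht i
      have hwm := h.w_mem ht i
      have hDm := h.D_mem ht i
      refine ⟨_, _, fun _ => ⟨P.add_sum_smul_mem_jointSubdiff hz.1 ha hbm, hw, hD, ?_, ?_⟩⟩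
      · exact norm_add_sum_smul_le hz
          (mem_closedBall_zero_iff.1 (hb.fw i _ hwm _ hDm (fst_mem_subdiff ha)))
          fun l => mem_closedBall_zero_iff.1 (hb.gw i l _ hwm _ hDm
            (fst_mem_subdiff (h := fun x y => P.g i x y l) (hbm l)))
      · exact norm_add_sum_smul_le hz
          (mem_closedBall_zero_iff.1 (hb.fD i _ hwm _ hDm (snd_mem_subdiff ha)))
          fun l => mem_closedBall_zero_iff.1 (hb.gD i l _ hwm _ hDm
            (snd_mem_subdiff (h := fun x y => P.g i x y l) (hbm l)))
    -- Time 0 is not part of the trajectory, so any value serves.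
    · exact ⟨0, 0, fun h => absurd h ht⟩
  choose ξw ξD hξ using hex
  exact ⟨ξw, ξD, fun t ht i => (hξ t i ht).1, fun t ht i => (hξ t i ht).2.1,
    fun t ht i => (hξ t i ht).2.2.1, fun t ht i => (hξ t i ht).2.2.2.1,
    fun t ht i => (hξ t i ht).2.2.2.2⟩

theorem sum_sq_le_Hprimal_sq {a : Fin N → ℝ} {hf hg : ℝ} (h0 : ∀ i, 0 ≤ a i)
    (ha : ∀ i, a i ≤ hf + r * Real.sqrt m * hg) :
    ∑ i, a i ^ 2 ≤ Hprimal N m r hf hg ^ 2 := by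
  rw [Hprimal, Real.sq_sqrt (by positivity)]
  refine (sum_le_sum fun i _ => pow_le_pow_left₀ (h0 i) (ha i) 2).trans ?_
  simp

section Trajectory

variable {ξw : ℕ → P.Locals} {ξD : ℕ → Fin N → EuclideanSpace ℝ (Fin d)} {e Λ : ℝ} {B : ℕ}

theorem IsPrimalGradient.phi_sub_le
    (hξ : P.IsPrimalGradient Hfw HfD Hgw HgD r σ η G w D z ξw ξD) {t : ℕ} (ht : 1 ≤ t)
    (pw : P.Locals) (pD : EuclideanSpace ℝ (Fin d)) :
    P.phi (w t) (D t) (z t) - P.phi pw (fun _ => pD) (z t) ≤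
      ∑ i, inner ℝ (ξw t i) (w t i - pw i) + ∑ i, inner ℝ (ξD t i) (D t i - pD) := by
  rw [phi_eq, phi_eq, ← sum_sub_distrib, ← sum_add_distrib]
  refine sum_le_sum fun i _ => ?_
  have h := hξ.mem t ht i (pw i) pD
  rw [← neg_sub (w t i), ← neg_sub (D t i), inner_neg_right, inner_neg_right] at h
  linarith

theorem IsPrimalGradient.sum_local_regret_le
    (hξ : P.IsPrimalGradient Hfw HfD Hgw HgD r σ η G w D z ξw ξD)
    (h : P.IsTrajectory r σ η G w D z) (hη : DoublingTrick η) (hW : ∀ i, IsCompact (P.W i))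
    {pw : P.Locals} (hpw : ∀ i, pw i ∈ P.W i) {T : ℕ} (hT : 1 ≤ T) :
    ∑ s ∈ Ico 1 (T + 1), ∑ i, inner ℝ (ξw s i) (w s i - pw i) ≤
      doublingConst * (P.Bw ^ 2 / 2 + Hprimal N m r Hfw Hgw ^ 2 / 2) * Real.sqrt T := by
  refine hη.sum_regret_le (V := fun t => ∑ i, ‖w t i - pw i‖ ^ 2) (sq_nonneg _) (sq_nonneg _)
    (fun s _ => sum_nonneg fun _ _ => sq_nonneg _) (fun s hs => ?_) (fun s hs => ?_) hT
  · rw [Bw, Real.sq_sqrt (by positivity)]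
    refine sum_le_sum fun i _ => pow_le_pow_left₀ (norm_nonneg _) ?_ 2
    rw [← dist_eq_norm]
    exact Metric.dist_le_diam_of_mem (hW i).isBounded (h.w_mem hs i) (hpw i)
  · have hsum := sum_le_sum fun i (_ : i ∈ univ) =>
      (hξ.step_w s hs i).two_mul_inner_le (P.convex_W i) (hpw i)
    rw [← mul_sum, sum_add_distrib, sum_sub_distrib, ← mul_sum] at hsum
    have hH := mul_le_mul_of_nonneg_left (sum_sq_le_Hprimal_sq (fun i => norm_nonneg (ξw s i))
      (hξ.norm_w s hs)) (sq_nonneg (η s))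
    linarith

theorem IsPrimalGradient.consensusSeq
    (hξ : P.IsPrimalGradient Hfw HfD Hgw HgD r σ η G w D z ξw ξD)
    (h : P.IsTrajectory r σ η G w D z) :
    ConsensusSeq P.Dset G σ η D ξD (Hprimal N m r HfD HgD) where
  mem _ ht i := h.D_mem ht i
  step := hξ.step_D
  bound t ht := (famNorm_le_iff (Real.sqrt_nonneg _)).2
    (sum_sq_le_Hprimal_sq (fun i => norm_nonneg (ξD t i)) (hξ.norm_D t ht))

theorem IsTrajectory.consensusSeq_multiplier (h : P.IsTrajectory r σ η G w D z)
    (hW : ∀ i, IsCompact (P.W i)) (hD : IsCompact P.Dset) :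
    ConsensusSeq (multiplierSet m r) G σ η z (fun t i => -P.g i (w t i) (D t i)) P.Hz where
  mem t ht i := h.z_mem ht i
  step t ht i := by
    obtain ⟨a, b, -, -, -, -, hz⟩ := h.step t ht i
    rwa [smul_neg, sub_neg_eq_add]
  bound t ht := by
    simp only [famNorm, norm_neg]
    exact famNorm_g_le hW hD (fun i => h.w_mem ht i) fun i => h.D_mem ht i

theorem sum_dist_sq_le_BD_sq (hD : IsCompact P.Dset) {x : Fin N → EuclideanSpace ℝ (Fin d)}
    (hx : ∀ i, x i ∈ P.Dset) {p : EuclideanSpace ℝ (Fin d)} (hp : p ∈ P.Dset) :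
    ∑ i, ‖x i - p‖ ^ 2 ≤ P.BD ^ 2 := by
  rw [BD, mul_pow, Real.sq_sqrt (Nat.cast_nonneg N)]
  refine (sum_le_sum fun i _ => pow_le_pow_left₀ (norm_nonneg _)
    (?_ : ‖x i - p‖ ≤ Metric.diam P.Dset) 2).trans (by simp)
  rw [← dist_eq_norm]
  exact Metric.dist_le_diam_of_mem hD.isBounded (hx i) hp

theorem BD_nonneg (P : Problem N m d) : 0 ≤ P.BD :=
  mul_nonneg (Real.sqrt_nonneg _) Metric.diam_nonneg

theorem IsTrajectory.disagreement_D_le (h : P.IsTrajectory r σ η G w D z) (hN : 1 ≤ N)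
    (hD : IsCompact P.Dset) {t : ℕ} (ht : 1 ≤ t) : disagreement (D t) ≤ P.BD :=
  (famNorm_le_iff P.BD_nonneg).2 (sum_dist_sq_le_BD_sq hD (h.D_mem ht)
    (Convex.mean_mem P.convex_Dset hN (h.D_mem ht)))

theorem IsTrajectory.radius_nonneg (h : P.IsTrajectory r σ η G w D z) (hN : 1 ≤ N) : 0 ≤ r :=
  (norm_nonneg _).trans (norm_le_of_mem_multiplierSet (h.init_z ⟨0, hN⟩))

theorem IsTrajectory.disagreement_z_le (h : P.IsTrajectory r σ η G w D z) (hN : 1 ≤ N)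
    {t : ℕ} (ht : 1 ≤ t) : disagreement (z t) ≤ Bz N r := by
  refine (disagreement_le_famNorm _).trans ((famNorm_le_iff
    (mul_nonneg (Real.sqrt_nonneg _) (h.radius_nonneg hN))).2 ?_)
  rw [mul_pow, Real.sq_sqrt (Nat.cast_nonneg N)]
  exact (sum_le_sum fun i _ => pow_le_pow_left₀ (norm_nonneg _)
    (norm_le_of_mem_multiplierSet (h.z_mem ht i)) 2).trans (by simp)

theorem IsTrajectory.sum_dist_sq_z_le (h : P.IsTrajectory r σ η G w D z)
    {t : ℕ} (ht : 1 ≤ t) {p : EuclideanSpace ℝ (Fin m)} (hp : p ∈ multiplierSet m r) :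
    ∑ i, ‖z t i - p‖ ^ 2 ≤ 4 * Bz N r ^ 2 := by
  rw [Bz, mul_pow, Real.sq_sqrt (Nat.cast_nonneg N)]
  -- Two points of the ball are within 2r; halved in the regret bound, the factor 4 uses up the term
  -- 4 B_z² of `alpha` exactly.
  refine (sum_le_sum fun i _ => pow_le_pow_left₀ (norm_nonneg _)
    (?_ : ‖z t i - p‖ ≤ 2 * r) 2).trans (le_of_eq ?_)
  · have h1 := norm_le_of_mem_multiplierSet (h.z_mem ht i)
    have h2 := norm_le_of_mem_multiplierSet hp
    linarith [norm_sub_le (z t i) p]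
  · simp only [sum_const, card_univ, Fintype.card_fin, nsmul_eq_mul]
    ring

theorem IsPrimalGradient.sum_phi_primal_regret_le
    (hξ : P.IsPrimalGradient Hfw HfD Hgw HgD r σ η G w D z ξw ξD)
    (h : P.IsTrajectory r σ η G w D z) (hG : MixingNetwork G σ e Λ B) (hη : DoublingTrick η)
    (hW : ∀ i, IsCompact (P.W i)) (hD : IsCompact P.Dset) {pw : P.Locals}
    (hpw : ∀ i, pw i ∈ P.W i) {pD : EuclideanSpace ℝ (Fin d)} (hpD : pD ∈ P.Dset) {T : ℕ}
    (hT : 1 ≤ T) :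
    ∑ s ∈ Ico 1 (T + 1), (P.phi (w s) (D s) (z s) - P.phi pw (fun _ => pD) (z s)) ≤
      doublingConst * (P.Bw ^ 2 / 2 + Hprimal N m r Hfw Hgw ^ 2 / 2 + (P.BD ^ 2 / 2 +
        Hprimal N m r HfD HgD ^ 2 / 2 + Hprimal N m r HfD HgD * (σ * Λ) *
        (Cu N B e / 2 * (P.BD + Hprimal N m r HfD HgD)))) * Real.sqrt T := by
  refine (sum_le_sum fun s hs => hξ.phi_sub_le (mem_Ico.1 hs).1 pw pD).trans ?_
  rw [sum_add_distrib]
  have h1 := hξ.sum_local_regret_le h hη hW hpw hT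
  have h2 := (hξ.consensusSeq h).sum_regret_le hG P.convex_Dset hη
    (fun t ht => h.disagreement_D_le hG.card_pos hD ht) hpD
    (fun t ht => sum_dist_sq_le_BD_sq hD (h.D_mem ht) hpD) hT
  linarith

theorem IsTrajectory.sum_phi_dual_regret_le
    (h : P.IsTrajectory r σ η G w D z) (hG : MixingNetwork G σ e Λ B) (hη : DoublingTrick η)
    (hW : ∀ i, IsCompact (P.W i)) (hD : IsCompact P.Dset) {p : EuclideanSpace ℝ (Fin m)}
    (hp : p ∈ multiplierSet m r) {T : ℕ} (hT : 1 ≤ T) :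
    ∑ s ∈ Ico 1 (T + 1), (P.phi (w s) (D s) (fun _ => p) - P.phi (w s) (D s) (z s)) ≤
      doublingConst * (2 * Bz N r ^ 2 + P.Hz ^ 2 / 2 + P.Hz * (σ * Λ) *
        (Cu N B e / 2 * (Bz N r + P.Hz))) * Real.sqrt T := by
  have h2 := (h.consensusSeq_multiplier hW hD).sum_regret_le hG convex_multiplierSet hη
    (fun t ht => h.disagreement_z_le hG.card_pos ht) hp
    (fun t ht => h.sum_dist_sq_z_le ht hp) hT
  refine le_trans (sum_le_sum fun s _ => le_of_eq ?_) (h2.trans (le_of_eq (by ring)))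
  rw [phi_sub_phi_multiplier]
  refine sum_congr rfl fun i _ => ?_
  rw [inner_neg_left, ← inner_neg_right, neg_sub, real_inner_comm]

theorem IsTrajectory.phi_runAvg_sub_le (h : P.IsTrajectory r σ η G w D z)
    (hb : P.SubdiffBounds Hfw HfD Hgw HgD) (hG : MixingNetwork G σ e Λ B) (hη : DoublingTrick η)
    (hW : ∀ i, IsCompact (P.W i)) (hD : IsCompact P.Dset) {wstar : P.Locals}
    {Dstar : EuclideanSpace ℝ (Fin d)} {zstar : EuclideanSpace ℝ (Fin m)}
    (hs : P.IsSaddle wstar Dstar zstar) {T : ℕ} (hT : 1 ≤ T) :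
    T * (P.phi (runAvg w (T + 1)) (runAvg D (T + 1)) (runAvg z (T + 1)) -
        P.lagrangian wstar Dstar zstar) ≤
      doublingConst * (P.Bw ^ 2 / 2 + Hprimal N m r Hfw Hgw ^ 2 / 2 + (P.BD ^ 2 / 2 +
        Hprimal N m r HfD HgD ^ 2 / 2 + Hprimal N m r HfD HgD * (σ * Λ) *
        (Cu N B e / 2 * (P.BD + Hprimal N m r HfD HgD))) + (2 * Bz N r ^ 2 + P.Hz ^ 2 / 2 +
        P.Hz * (2 + σ * Λ) * (Cu N B e / 2 * (Bz N r + P.Hz)))) * Real.sqrt T := by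
  obtain ⟨ξw, ξD, hξ⟩ := h.exists_isPrimalGradient hb
  have hN := hG.card_pos
  have hzav : ∀ i, runAvg z (T + 1) i ∈ multiplierSet m r := fun i => by
    have := Convex.runAvg_mem convex_multiplierSet hT (x := fun s => z s i)
      fun s hs => h.z_mem hs i
    rw [runAvg_succ] at this ⊢
    simpa [Finset.sum_apply] using this
  -- The dual regret needs a single comparator, whereas the averaged multipliers still differ
  -- between agents.
  set zb := mean (runAvg z (T + 1)) with hzb
  have hzbm : zb ∈ multiplierSet m r := Convex.mean_mem convex_multiplierSet hN hzav
  have h1 := P.phi_runAvg_primal_le hT w D fun i => (hzav i).1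
  have hprim := hξ.sum_phi_primal_regret_le h hG hη hW hD hs.w_mem hs.D_mem hT
  have hdual := h.sum_phi_dual_regret_le hG hη hW hD hzbm hT
  have hdis := (h.consensusSeq_multiplier hW hD).sum_disagreement_le hG convex_multiplierSet hη
    (fun t ht => h.disagreement_z_le hN ht) hT
  have hdisav := disagreement_runAvg_le hT z
  -- The two disagreements come from moving to the comparator `zb` and from replacing z s by its
  -- mean, where the dual saddle inequality applies.
  have hterm : ∀ s ∈ Ico 1 (T + 1), P.phi (w s) (D s) (runAvg z (T + 1)) ≤
      P.Hz * disagreement (runAvg z (T + 1)) +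
      (P.phi (w s) (D s) (fun _ => zb) - P.phi (w s) (D s) (z s)) +
      (P.phi (w s) (D s) (z s) - P.phi wstar (fun _ => Dstar) (z s)) +
      P.Hz * disagreement (z s) + P.lagrangian wstar Dstar zstar := by
    intro s hs'
    have hs1 := (mem_Ico.1 hs').1
    have e1 := phi_sub_phi_mean_le hW hD (fun i => h.w_mem hs1 i) (fun i => h.D_mem hs1 i)
      (runAvg z (T + 1))
    have e2 := phi_sub_phi_mean_le hW hD hs.w_mem (fun _ => hs.D_mem) (z s)
    have e3 := hs.dual (mean (z s)) (Convex.mean_mem convex_orthant hN fun i => (h.z_mem hs1 i).1)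
    rw [lagrangian] at e3
    rw [← hzb] at e1
    linarith
  have hsum := sum_le_sum hterm
  simp only [sum_add_distrib, sum_const, Nat.card_Ico, Nat.add_sub_cancel, nsmul_eq_mul,
    ← mul_sum] at hsum
  have hH := P.Hz_nonneg
  have e4 := mul_le_mul_of_nonneg_left hdisav hH
  have e5 := mul_le_mul_of_nonneg_left hdis hH
  linarith

theorem IsTrajectory.le_phi_runAvg_sub (h : P.IsTrajectory r σ η G w D z)
    (hb : P.SubdiffBounds Hfw HfD Hgw HgD) (hG : MixingNetwork G σ e Λ B) (hη : DoublingTrick η)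
    (hW : ∀ i, IsCompact (P.W i)) (hD : IsCompact P.Dset)
    (hr : P.optimalDualSet ⊆ Metric.closedBall 0 r) {wstar : P.Locals}
    {Dstar : EuclideanSpace ℝ (Fin d)} {zstar : EuclideanSpace ℝ (Fin m)}
    (hs : P.IsSaddle wstar Dstar zstar) {T : ℕ} (hT : 1 ≤ T) :
    -(doublingConst * (P.Bw ^ 2 / 2 + Hprimal N m r Hfw Hgw ^ 2 / 2 + (P.BD ^ 2 / 2 +
        Hprimal N m r HfD HgD ^ 2 / 2 + Hprimal N m r HfD HgD * (2 + σ * Λ) *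
        (Cu N B e / 2 * (P.BD + Hprimal N m r HfD HgD))) + (2 * Bz N r ^ 2 + P.Hz ^ 2 / 2 +
        P.Hz * (σ * Λ) * (Cu N B e / 2 * (Bz N r + P.Hz)))) * Real.sqrt T) ≤
      T * (P.phi (runAvg w (T + 1)) (runAvg D (T + 1)) (runAvg z (T + 1)) -
        P.lagrangian wstar Dstar zstar) := by
  obtain ⟨ξw, ξD, hξ⟩ := h.exists_isPrimalGradient hb
  have hN := hG.card_pos
  -- The dual comparator must lie in the projection set, hence the requirement on the radius.
  have hzs : zstar ∈ multiplierSet m r := ⟨hs.z_mem, hr hs.mem_optimalDualSet⟩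
  have hwav : ∀ i, runAvg w (T + 1) i ∈ P.W i := fun i => by
    have := Convex.runAvg_mem (P.convex_W i) hT (x := fun s => w s i) fun s hs => h.w_mem hs i
    rw [runAvg_succ] at this ⊢
    simpa [Finset.sum_apply] using this
  have hDav : ∀ i, runAvg D (T + 1) i ∈ P.Dset := fun i => by
    have := Convex.runAvg_mem P.convex_Dset hT (x := fun s => D s i) fun s hs => h.D_mem hs i
    rw [runAvg_succ] at this ⊢
    simpa [Finset.sum_apply] using this
  set Db := mean (runAvg D (T + 1)) with hDb
  have hDbm : Db ∈ P.Dset := Convex.mean_mem P.convex_Dset hN hDav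
  have h1 := P.phi_runAvg_dual hT (runAvg w (T + 1)) (runAvg D (T + 1)) z
  have hprim := hξ.sum_phi_primal_regret_le h hG hη hW hD hwav hDbm hT
  have hdual := h.sum_phi_dual_regret_le hG hη hW hD hzs hT
  have hdis := (hξ.consensusSeq h).sum_disagreement_le hG P.convex_Dset hη
    (fun t ht => h.disagreement_D_le hN hD ht) hT
  have hdisav := disagreement_runAvg_le hT D
  set HD := Hprimal N m r HfD HgD with hHD
  -- The mirror image: the copies of D are replaced by their mean, once for the running average and
  -- once at time s, where the primal saddle inequality applies.
  have hterm : ∀ s ∈ Ico 1 (T + 1), P.lagrangian wstar Dstar zstar ≤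
      P.phi (runAvg w (T + 1)) (runAvg D (T + 1)) (z s) +
      HD * disagreement (runAvg D (T + 1)) +
      (P.phi (w s) (D s) (z s) - P.phi (runAvg w (T + 1)) (fun _ => Db) (z s)) +
      (P.phi (w s) (D s) (fun _ => zstar) - P.phi (w s) (D s) (z s)) +
      HD * disagreement (D s) := by
    intro s hs'
    have hs1 := (mem_Ico.1 hs').1
    have e1 := hb.phi_mean_sub_le hN (h.z_mem hs1) hwav hDav
    have e2 := hb.phi_mean_sub_le hN (fun _ => hzs) (fun i => h.w_mem hs1 i)
      (fun i => h.D_mem hs1 i)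
    have e3 := hs.primal (w s) (mean (D s)) (fun i => h.w_mem hs1 i)
      (Convex.mean_mem P.convex_Dset hN fun i => h.D_mem hs1 i)
    rw [lagrangian, lagrangian] at e3
    rw [lagrangian]
    rw [← hDb] at e1
    linarith
  have hsum := sum_le_sum hterm
  simp only [sum_add_distrib, sum_const, Nat.card_Ico, Nat.add_sub_cancel, nsmul_eq_mul,
    ← mul_sum] at hsum
  have hH : 0 ≤ HD := Real.sqrt_nonneg _
  have e4 := mul_le_mul_of_nonneg_left hdisav hH
  have e5 := mul_le_mul_of_nonneg_left hdis hH
  linarith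

end Trajectory

end Problem

theorem mixingNetwork_of_connected {N : ℕ} (hN : 1 ≤ N) {G : ℕ → WeightedDigraph N} {B : ℕ}
    (hB : 1 ≤ B) (hconn : WeightedDigraph.JointlyConnected G B) {δ : ℝ} (hδ : 0 < δ)
    (hnondeg : WeightedDigraph.Nondegenerate G δ) (hbal : ∀ t, 1 ≤ t → (G t).WeightBalanced)
    {Λ : ℝ} (hΛ : ∀ t, 1 ≤ t → maxSingularValue (G t).laplacian ≤ Λ) {dmax : ℝ}
    (hdmax : IsLUB (WeightedDigraph.outDegrees G) dmax) {δ' : ℝ} (hδ'_pos : 0 < δ')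
    (hδ'_lt : δ' < 1) {σ : ℝ} (hσ : StepsizeCond σ (tildeDelta δ' δ dmax) δ dmax) :
    MixingNetwork G σ (tildeDelta δ' δ dmax) Λ B := by
  have hdeg : ∀ t, 1 ≤ t → ∀ i, (G t).outDegree i ≤ dmax := fun t ht i =>
    hdmax.1 ⟨t, ht, i, rfl⟩
  have hd0 : 0 ≤ dmax := ((G 1).outDegree_nonneg ⟨0, hN⟩).trans (hdeg 1 le_rfl _)
  have he := tildeDelta_pos hδ hδ'_pos hδ'_lt hd0
  have he1 : tildeDelta δ' δ dmax ≤ 1 := tildeDelta_le.trans hδ'_lt.le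
  have hσpos : 0 < σ := (div_pos he hδ).trans_le hσ.1
  exact
    { card_pos := hN
      e_pos := he
      e_le := he1
      window_pos := hB
      σ_nonneg := hσpos.le
      averaging := fun t ht => WeightedDigraph.isAveraging_averagingMatrix hσpos.le he.le
        (hbal t ht) (fun i => hσ.mul_le hσpos.le he1 ((G t).outDegree_nonneg i) (hdeg t ht i))
        (hnondeg t ht) ((div_le_iff₀ hδ).1 hσ.1)
      connected := fun k hk => WeightedDigraph.windowConnected_averagingMatrix hσpos (hconn k hk)
      singular_le := hΛ }

/-- j counts the replacements of copies by their mean, and c = σΛ is the consensus error in the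
regret. Both 3 and b + 2H leave slack. -/
theorem consensus_const_le {H c C b j : ℝ} (hH : 0 ≤ H) (hc : 0 ≤ c) (hC : 0 ≤ C) (hb : 0 ≤ b)
    (hj : j ≤ 3) : H * (j + c) * (C / 2 * (b + H)) ≤ H * (3 + c) * C * (b + 2 * H) / 2 := by
  have h1 : H * (j + c) ≤ H * (3 + c) := mul_le_mul_of_nonneg_left (by linarith) hH
  have h2 : C / 2 * (b + H) ≤ C / 2 * (b + 2 * H) :=
    mul_le_mul_of_nonneg_left (by linarith) (by linarith)
  calc H * (j + c) * (C / 2 * (b + H)) ≤ H * (3 + c) * (C / 2 * (b + 2 * H)) :=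
        mul_le_mul h1 h2 (by positivity) (by positivity)
    _ = _ := by ring

theorem regret_const_le {Bw BD Bz Hw HD Hz c C jD jz : ℝ} (hHD : 0 ≤ HD) (hHz : 0 ≤ Hz)
    (hc : 0 ≤ c) (hC : 0 ≤ C) (hBD : 0 ≤ BD) (hBz : 0 ≤ Bz) (hjD : jD ≤ 3) (hjz : jz ≤ 3)
    {σ Λ : ℝ} (hσΛ : c = σ * Λ) :
    Bw ^ 2 / 2 + Hw ^ 2 / 2 + (BD ^ 2 / 2 + HD ^ 2 / 2 + HD * (jD + c) * (C / 2 * (BD + HD))) +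
      (2 * Bz ^ 2 + Hz ^ 2 / 2 + Hz * (jz + c) * (C / 2 * (Bz + Hz))) ≤
      (alpha Bw BD Hw HD σ Λ C + alpha 0 Bz 0 Hz σ Λ C) / 2 := by
  have h1 := consensus_const_le hHD hc hC hBD hjD
  have h2 := consensus_const_le hHz hc hC hBz hjz
  rw [alpha, alpha, ← hσΛ]
  nlinarith [sq_nonneg Bw, sq_nonneg Hw, sq_nonneg BD, sq_nonneg HD, sq_nonneg Bz, sq_nonneg Hz]

theorem le_div_sqrt_of_mul_le {T : ℕ} (hT : 1 ≤ T) {X c α : ℝ}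
    (h : T * X ≤ doublingConst * c * Real.sqrt T) (hc : c ≤ α / 2) :
    X ≤ doublingConst * α / (2 * Real.sqrt T) := by
  have hT' : (0 : ℝ) < T := by positivity
  have hs : 0 < Real.sqrt T := Real.sqrt_pos.2 hT'
  have hss : Real.sqrt T * Real.sqrt T = T := Real.mul_self_sqrt hT'.le
  have h1 : doublingConst * c * Real.sqrt T ≤ doublingConst * (α / 2) * Real.sqrt T :=
    mul_le_mul_of_nonneg_right (mul_le_mul_of_nonneg_left hc doublingConst_pos.le) hs.le
  have h2 : Real.sqrt T * (Real.sqrt T * X) ≤ Real.sqrt T * (doublingConst * (α / 2)) := by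
    rw [← mul_assoc, hss]; linarith
  have h3 := le_of_mul_le_mul_left h2 hs
  rw [le_div_iff₀ (by positivity)]
  linarith

end Main

end CSPSG

theorem mainTheorem3 {N m d : ℕ} (hN : 1 ≤ N) (P : CSPSG.Problem N m d)
    -- the primal sets are compact (their convexity is part of `P`)
    (hW : ∀ i, IsCompact (P.W i)) (hD : IsCompact P.Dset)
    -- the projection ball contains the optimal dual set
    (r : ℝ) (hr : P.optimalDualSet ⊆ Metric.closedBall 0 r)
    -- bounds on the subdifferentials over `W i × Dset`
    (Hfw HfD Hgw HgD : ℝ)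
    (hfw : ∀ i, ∀ x ∈ P.W i, ∀ y ∈ P.Dset,
      CSPSG.subdiff (fun x' => P.f i x' y) x ⊆ Metric.closedBall 0 Hfw)
    (hfD : ∀ i, ∀ x ∈ P.W i, ∀ y ∈ P.Dset,
      CSPSG.subdiff (fun y' => P.f i x y') y ⊆ Metric.closedBall 0 HfD)
    (hgw : ∀ i l, ∀ x ∈ P.W i, ∀ y ∈ P.Dset,
      CSPSG.subdiff (fun x' => P.g i x' y l) x ⊆ Metric.closedBall 0 Hgw)
    (hgD : ∀ i l, ∀ x ∈ P.W i, ∀ y ∈ P.Dset,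
      CSPSG.subdiff (fun y' => P.g i x y' l) y ⊆ Metric.closedBall 0 HgD)
    -- the sequence of digraphs
    (G : ℕ → CSPSG.WeightedDigraph N)
    (B : ℕ) (hB : 1 ≤ B) (hconn : CSPSG.WeightedDigraph.JointlyConnected G B)
    (δ : ℝ) (hδ : 0 < δ) (hnondeg : CSPSG.WeightedDigraph.Nondegenerate G δ)
    (hbal : ∀ t, 1 ≤ t → (G t).WeightBalanced)
    (Λ : ℝ) (hΛ : ∀ t, 1 ≤ t → CSPSG.maxSingularValue (G t).laplacian ≤ Λ)
    (dmax : ℝ) (hdmax : IsLUB (CSPSG.WeightedDigraph.outDegrees G) dmax)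
    -- the consensus stepsize
    (δ' : ℝ) (hδ'_pos : 0 < δ') (hδ'_lt : δ' < 1)
    (σ : ℝ) (hσ : CSPSG.StepsizeCond σ (CSPSG.tildeDelta δ' δ dmax) δ dmax)
    -- the learning rates
    (η : ℕ → ℝ) (hη : CSPSG.DoublingTrick η)
    -- the sequence generated by the algorithm
    (w : ℕ → P.Locals) (D : ℕ → Fin N → EuclideanSpace ℝ (Fin d))
    (z : ℕ → Fin N → EuclideanSpace ℝ (Fin m)) (htraj : P.IsTrajectory r σ η G w D z)
    -- any saddle point of the Lagrangian
    (wstar : P.Locals) (Dstar : EuclideanSpace ℝ (Fin d)) (zstar : EuclideanSpace ℝ (Fin m))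
    (hsaddle : P.IsSaddle wstar Dstar zstar)
    (αwD αμz : ℝ)
    (hαwD : αwD = CSPSG.alphaHat P.Bw P.BD
      (CSPSG.Hprimal N m r Hfw Hgw) (CSPSG.Hprimal N m r HfD HgD)
      σ Λ (CSPSG.Cu N B (CSPSG.tildeDelta δ' δ dmax)))
    (hαμz : αμz = CSPSG.alphaHat 0 (CSPSG.Bz N r) 0 P.Hz
      σ Λ (CSPSG.Cu N B (CSPSG.tildeDelta δ' δ dmax)))
    (t : ℕ) (ht : 2 ≤ t) :
    -((αμz + αwD) / (2 * Real.sqrt ((t : ℝ) - 1))) ≤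
        P.phi (CSPSG.runAvg w t) (CSPSG.runAvg D t) (CSPSG.runAvg z t)
          - P.lagrangian wstar Dstar zstar ∧
      P.phi (CSPSG.runAvg w t) (CSPSG.runAvg D t) (CSPSG.runAvg z t)
          - P.lagrangian wstar Dstar zstar ≤
        (αwD + αμz) / (2 * Real.sqrt ((t : ℝ) - 1)) := by
  obtain ⟨T, rfl⟩ : ∃ T, t = T + 1 := ⟨t - 1, by omega⟩
  have hT : 1 ≤ T := by omega
  have hG := CSPSG.mixingNetwork_of_connected hN hB hconn hδ hnondeg hbal hΛ hdmax hδ'_pos hδ'_lt hσ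
  have hb : P.SubdiffBounds Hfw HfD Hgw HgD := ⟨hfw, hfD, hgw, hgD⟩
  have hup := htraj.phi_runAvg_sub_le hb hG hη hW hD hsaddle hT
  have hlow := htraj.le_phi_runAvg_sub hb hG hη hW hD hr hsaddle hT
  have hHD : 0 ≤ CSPSG.Hprimal N m r HfD HgD := Real.sqrt_nonneg _
  have hBz : 0 ≤ CSPSG.Bz N r := mul_nonneg (Real.sqrt_nonneg _) (htraj.radius_nonneg hN)
  have hσΛ := mul_nonneg hG.σ_nonneg hG.Λ_nonneg
  have hcast : ((T + 1 : ℕ) : ℝ) - 1 = T := by push_cast; ring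
  have hα : ∀ B₁ B₂ H₁ H₂ C, CSPSG.alphaHat B₁ B₂ H₁ H₂ σ Λ C =
      CSPSG.doublingConst * CSPSG.alpha B₁ B₂ H₁ H₂ σ Λ C := fun _ _ _ _ _ => rfl
  rw [hcast, hαwD, hαμz, hα, hα, add_comm (CSPSG.doublingConst * _), ← mul_add]
  constructor
  · rw [neg_le]
    -- The lower bound replaces copies of D twice and those of z never; the upper bound does the
    -- reverse.
    refine CSPSG.le_div_sqrt_of_mul_le hT ?_
      (CSPSG.regret_const_le (jD := 2) (jz := 0) hHD P.Hz_nonneg hσΛ hG.Cu_nonneg P.BD_nonneg hBz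
        (by norm_num) (by norm_num) rfl)
    rw [mul_neg, neg_le, zero_add]
    exact hlow
  · refine CSPSG.le_div_sqrt_of_mul_le hT ?_
      (CSPSG.regret_const_le (jD := 0) (jz := 2) hHD P.Hz_nonneg hσΛ hG.Cu_nonneg P.BD_nonneg hBz
        (by norm_num) (by norm_num) rfl)
    rw [zero_add]
    exact hup
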